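/- Let $C_{\mathbb Z}$ be one of the following rings with norm $n$, trace $t$ and conjugation $x\mapsto\bar x$: the split quaternions $\mathbb H_{\mathbb Z}=M_2(\mathbb Z)$, with $n=\det$, $t$ the matrix trace and $\overline{\begin{pmatrix}a&b\\c&d\end{pmatrix}}=\begin{pmatrix}d&-b\\-c&a\end{pmatrix}$; the split binarions $\mathbb B_{\mathbb Z}\subset\mathbb H_{\mathbb Z}$, the subring of diagonal matrices; the split octonions $\mathbb O_{\mathbb Z}=\mathbb H_{\mathbb Z}\oplus\mathbb H_{\mathbb Z}v$, with $(a+bv)(c+dv)=(ac-\bar d\,b)+(da+b\bar c)v$, $n(a+bv)=\det a+\det b$, $t(a+bv)=t(a)$ and $\overline{a+bv}=\bar a-bv$. Let $H_3(C_{\mathbb Z})$ be the $\mathbb Z$-module of Hermitian matrices $$A=\begin{pmatrix}a&z&\bar y\\ \bar z&b&x\\ y&\bar x&c\end{pmatrix},\qquad a,b,c\in\mathbb Z,\ x,y,z\in C_{\mathbb Z},$$ with cubic norm $N(A)=abc-a\,n(x)-b\,n(y)-c\,n(z)+t((xy)z)$, trace bilinear form $(A,A')=aa'+bb'+cc'+t(x\bar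 x')+t(y\bar y')+t(z\bar z')$, and adjoint map $A\mapsto A^\#$, where $A^\#$ is the Hermitian matrix with diagonal entries $bc-n(x),\ ac-n(y),\ ab-n(z)$ and with $\overline{yz}-ax,\ \overline{zx}-by,\ \overline{xy}-cz$ in the places of $x,y,z$. On $\mathbb Z^3$ let $N(a,b,c)=abc$, let $(\cdot,\cdot)$ be the standard scalar product, and let $(a,b,c)^\#=(bc,ac,ab)$. In all cases put $A\times B=(A+B)^\#-A^\#-B^\#$. Let $J_{\mathbb Z}$ be one of $H_3(\mathbb B_{\mathbb Z})$, $H_3(\mathbb H_{\mathbb Z})$, $H_3(\mathbb O_{\mathbb Z})$, $\mathbb Z\oplus\mathbb Z\oplus\mathbb Z$, and let $M(J_{\mathbb Z})=\mathbb Z\oplus\mathbb Z\oplus J_{\mathbb Z}\oplus J_{\mathbb Z}$. For $x=(\alpha,\beta,A,B)$ and $y=(\gamma,\delta,C,D)$ in $M(J_{\mathbb Z})$ let $$\{x,y\}=\alpha\delta-\beta\gamma+(A,D)-(B,C),$$ $$q(x)=8(A^\#,B^\#)-8\alpha N(A)-8\beta N(B)-2\big((A,B)-\alpha\beta\big)^2.$$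 Let $G_{\mathbb Z}$ be the group of all invertible $\mathbb Z$-linear transformations of $M(J_{\mathbb Z})$ that preserve $q$ and $\{\cdot,\cdot\}$. Let $\mathrm{Str}(J_{\mathbb Z})$ be the group of all $s\in GL(J_{\mathbb Z})$ for which there is a scalar $\lambda$ (necessarily $\lambda=\pm1$) with $N(s(A))=\lambda N(A)$ for all $A\in J_{\mathbb Z}$, and let $s^*$ be the adjoint of $s$ with respect to $(\cdot,\cdot)$. Then $G_{\mathbb Z}$ is generated by the elementary transformations $\varphi(C)$, $\psi(D)$, $T(s)$ and $\tau$, with $C,D\in J_{\mathbb Z}$ and $s\in\mathrm{Str}(J_{\mathbb Z})$, where $$\varphi(C):(\alpha,\beta,A,B)\mapsto\big(\alpha+(B,C)+(A,C^\#)+\beta N(C),\ \beta,\ A+\beta C,\ B+A\times C+\beta C^\#\big),$$ $$\psi(D):(\alpha,\beta,A,B)\mapsto\big(\alpha,\ \beta+(A,D)+(B,D^\#)+\alpha N(D),\ A+B\times D+\alpha D^\#,\ B+\alpha D\big),$$ $$T(s):(\alpha,\beta,A,B)\mapsto\big(\lambda^{-1}\alpha,\ \lambda\beta,\ s(A),\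 (s^*)^{-1}(B)\big),$$ $$\tau:(\alpha,\beta,A,B)\mapsto(-\beta,\ \alpha,\ -B,\ A).$$ -/

import Mathlib

/-- A composition algebra over `ℤ` in which the trace form `tr (x ȳ)` (the linearization of the
norm) is unimodular. -/
structure CompositionRing (C : Type) [AddCommGroup C] where
  mul : C →ₗ[ℤ] C →ₗ[ℤ] C
  one : C
  conj : C →ₗ[ℤ] C
  trace : C →ₗ[ℤ] ℤ
  norm : QuadraticForm ℤ C
  one_mul : ∀ x, mul one x = x
  mul_one : ∀ x, mul x one = x
  norm_mul : ∀ x y, norm (mul x y) = norm x * norm y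
  conj_conj : ∀ x, conj (conj x) = x
  conj_mul : ∀ x y, conj (mul x y) = mul (conj y) (conj x)
  add_conj : ∀ x, x + conj x = trace x • one
  mul_conj : ∀ x, mul x (conj x) = norm x • one
  norm_add : ∀ x y, norm (x + y) = norm x + norm y + trace (mul x (conj y))
  norm_conj : ∀ x, norm (conj x) = norm x
  trace_conj : ∀ x, trace (conj x) = trace x
  trace_mul_comm : ∀ x y, trace (mul x y) = trace (mul y x)
  trace_mul_assoc : ∀ x y z, trace (mul (mul x y) z) = trace (mul x (mul y z))
  mul_mul_conj : ∀ x y, mul (mul x y) (conj y) = norm y • x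
  conj_mul_mul : ∀ x y, mul (conj x) (mul x y) = norm x • y
  moufang : ∀ x y z, mul (mul x y) (mul z x) =
    trace (mul (mul x y) z) • x - norm x • conj (mul y z)
  trace_form_bijective :
    Function.Bijective (mul.compl₁₂ (LinearMap.id : C →ₗ[ℤ] C) conj |>.compr₂ trace)

/-- A (unimodular) Jordan cubic over `ℤ`: a cubic form `norm` with basepoint `one`, its trace
bilinear form `form` and its adjoint map `sharp`, so that `norm_add` says
`(x♯, y) = 3 N(x, x, y)`, `form_eq` says `(x, y) = tr x · tr y - S(x, y)` with
`tr x = 3 N(1, 1, x)` and `S(x, y) = 6 N(x, y, 1)`, and `sharp_sharp` is the adjoint identity. -/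
structure JordanCubic (J : Type) [AddCommGroup J] where
  norm : J → ℤ
  one : J
  form : LinearMap.BilinForm ℤ J
  sharp : QuadraticMap ℤ J J
  norm_smul : ∀ (k : ℤ) x, norm (k • x) = k ^ 3 * norm x
  norm_add : ∀ x y, norm (x + y) = norm x + form (sharp x) y + form x (sharp y) + norm y
  norm_one : norm one = 1
  form_comm : ∀ x y, form x y = form y x
  form_eq : ∀ x y, form x y =
    form (sharp one) x * form (sharp one) y - form (sharp (x + y) - sharp x - sharp y) one
  sharp_sharp : ∀ x, sharp (sharp x) = norm x • x
  form_bijective : Function.Bijective form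

/-! ### The split composition rings -/

/-- The integral split binarions: the diagonal matrices `diag (a, d)` are written `(a, d)`. -/
def binarions : CompositionRing (ℤ × ℤ) where
  mul := LinearMap.mul ℤ (ℤ × ℤ)
  one := (1, 1)
  conj :=
    { toFun := fun x => (x.2, x.1)
      map_add' := fun _ _ => rfl
      map_smul' := fun _ _ => rfl }
  trace := LinearMap.fst ℤ ℤ ℤ + LinearMap.snd ℤ ℤ ℤ
  norm := QuadraticMap.ofPolar (fun x => x.1 * x.2)
    (by intro a x; simp; ring)
    (by intro x y z; simp [QuadraticMap.polar]; ring)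
    (by intro a x y; simp [QuadraticMap.polar]; ring)
  one_mul := by rintro ⟨a, b⟩; simp
  mul_one := by rintro ⟨a, b⟩; simp
  norm_mul := by rintro ⟨a, b⟩ ⟨c, d⟩; simp [QuadraticMap.ofPolar]; ring
  conj_conj := by rintro ⟨a, b⟩; simp
  conj_mul := by rintro ⟨a, b⟩ ⟨c, d⟩; simp [mul_comm]
  add_conj := by rintro ⟨a, b⟩; simp [add_comm]
  mul_conj := by rintro ⟨a, b⟩; simp [QuadraticMap.ofPolar, mul_comm]
  norm_add := by rintro ⟨a, b⟩ ⟨c, d⟩; simp [QuadraticMap.ofPolar]; ring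
  norm_conj := by rintro ⟨a, b⟩; simp [QuadraticMap.ofPolar, mul_comm]
  trace_conj := by rintro ⟨a, b⟩; simp [add_comm]
  trace_mul_comm := by rintro ⟨a, b⟩ ⟨c, d⟩; simp; ring
  trace_mul_assoc := by rintro ⟨a, b⟩ ⟨c, d⟩ ⟨e, f⟩; simp; ring
  mul_mul_conj := by
    rintro ⟨a, b⟩ ⟨c, d⟩
    ext <;> simp [QuadraticMap.ofPolar] <;> ring
  conj_mul_mul := by
    rintro ⟨a, b⟩ ⟨c, d⟩
    ext <;> simp [QuadraticMap.ofPolar] <;> ring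
  moufang := by
    rintro ⟨a, b⟩ ⟨c, d⟩ ⟨e, f⟩
    ext <;> simp [QuadraticMap.ofPolar] <;> ring
  trace_form_bijective := by
    constructor
    · rintro ⟨a, b⟩ ⟨c, d⟩ h
      have h1 := LinearMap.congr_fun h (1, 0)
      have h2 := LinearMap.congr_fun h (0, 1)
      simp at h1 h2
      simp [h1, h2]
    · intro f
      refine ⟨(f (0, 1), f (1, 0)), ?_⟩
      ext <;> simp

/-- The conjugation (symplectic involution) of a `2 × 2` matrix. -/
def quatConj : Matrix (Fin 2) (Fin 2) ℤ →ₗ[ℤ] Matrix (Fin 2) (Fin 2) ℤ where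
  toFun a := !![a 1 1, -a 0 1; -a 1 0, a 0 0]
  map_add' a b := by ext i j; fin_cases i <;> fin_cases j <;> simp <;> ring
  map_smul' k a := by ext i j; fin_cases i <;> fin_cases j <;> simp

/-- The determinant of a `2 × 2` matrix as a quadratic form. -/
def quatNorm : QuadraticForm ℤ (Matrix (Fin 2) (Fin 2) ℤ) :=
  QuadraticMap.ofPolar (fun a => a.det)
    (by intro k x; simp only [Matrix.det_fin_two, Matrix.smul_apply, smul_eq_mul]; ring)
    (by intro x y z; simp [-zsmul_eq_mul, -zsmul_one, -Matrix.cons_mul, QuadraticMap.polar,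
      Matrix.det_fin_two]; ring)
    (by intro k x y; simp [-zsmul_eq_mul, -zsmul_one, -Matrix.cons_mul, QuadraticMap.polar,
      Matrix.det_fin_two]; ring)

theorem quatNorm_apply (a : Matrix (Fin 2) (Fin 2) ℤ) :
    quatNorm a = a 0 0 * a 1 1 - a 0 1 * a 1 0 := Matrix.det_fin_two a

theorem quatConj_apply (a : Matrix (Fin 2) (Fin 2) ℤ) :
    quatConj a 0 0 = a 1 1 ∧ quatConj a 0 1 = -a 0 1 ∧
      quatConj a 1 0 = -a 1 0 ∧ quatConj a 1 1 = a 0 0 := ⟨rfl, rfl, rfl, rfl⟩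

/-- The integral split quaternions: integral `2 × 2` matrices with the determinant as norm. -/
def quaternions : CompositionRing (Matrix (Fin 2) (Fin 2) ℤ) where
  mul := LinearMap.mul ℤ (Matrix (Fin 2) (Fin 2) ℤ)
  one := 1
  conj := quatConj
  trace := Matrix.traceLinearMap (Fin 2) ℤ ℤ
  norm := quatNorm
  one_mul := by simp
  mul_one := by simp
  norm_mul x y := Matrix.det_mul x y
  conj_conj x := by ext i j; fin_cases i <;> fin_cases j <;> simp [-zsmul_eq_mul, -zsmul_one,
    -Matrix.cons_mul, quatConj_apply]
  conj_mul x y := by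
    ext i j
    fin_cases i <;> fin_cases j <;>
      simp [-zsmul_eq_mul, -zsmul_one, -Matrix.cons_mul, quatConj_apply, Matrix.mul_apply,
        Fin.sum_univ_two] <;> ring
  add_conj x := by
    ext i j
    fin_cases i <;> fin_cases j <;>
      simp [-zsmul_eq_mul, -zsmul_one, -Matrix.cons_mul, quatConj_apply, Matrix.trace,
        Fin.sum_univ_two] <;> ring
  mul_conj x := by
    ext i j
    fin_cases i <;> fin_cases j <;>
      simp [-zsmul_eq_mul, -zsmul_one, -Matrix.cons_mul, quatConj_apply, quatNorm_apply,
        Matrix.mul_apply, Fin.sum_univ_two] <;> ring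
  norm_add x y := by
    simp [-zsmul_eq_mul, -zsmul_one, -Matrix.cons_mul, quatConj_apply, quatNorm_apply,
      Matrix.mul_apply, Matrix.trace, Fin.sum_univ_two]; ring
  norm_conj x := by
    simp [quatConj_apply, quatNorm_apply]; ring
  trace_conj x := by
    simp [-zsmul_eq_mul, -zsmul_one, -Matrix.cons_mul, quatConj_apply, Matrix.trace,
      Fin.sum_univ_two]; ring
  trace_mul_comm x y := Matrix.trace_mul_comm x y
  trace_mul_assoc x y z := by simp [-zsmul_eq_mul, -zsmul_one, -Matrix.cons_mul, Matrix.mul_assoc]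
  mul_mul_conj x y := by
    ext i j
    fin_cases i <;> fin_cases j <;>
      simp [-zsmul_eq_mul, -zsmul_one, -Matrix.cons_mul, quatConj_apply, quatNorm_apply,
        Matrix.mul_apply, Fin.sum_univ_two] <;> ring
  conj_mul_mul x y := by
    ext i j
    fin_cases i <;> fin_cases j <;>
      simp [-zsmul_eq_mul, -zsmul_one, -Matrix.cons_mul, quatConj_apply, quatNorm_apply,
        Matrix.mul_apply, Fin.sum_univ_two] <;> ring
  moufang x y z := by
    ext i j
    fin_cases i <;> fin_cases j <;>
      simp [-zsmul_eq_mul, -zsmul_one, -Matrix.cons_mul, quatConj_apply, quatNorm_apply,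
        Matrix.mul_apply, Matrix.trace, Fin.sum_univ_two] <;>
      ring
  trace_form_bijective := by
    constructor
    · intro a b h
      have h0 := fun i j => LinearMap.congr_fun h (Matrix.single i j 1)
      have h1 := h0 0 0
      have h2 := h0 0 1
      have h3 := h0 1 0
      have h4 := h0 1 1
      simp [-zsmul_eq_mul, -zsmul_one, -Matrix.cons_mul, quatConj_apply, Matrix.trace,
        Matrix.mul_apply, Fin.sum_univ_two] at h1 h2 h3 h4
      ext i j
      fin_cases i <;> fin_cases j <;> simp [-zsmul_eq_mul, -zsmul_one, -Matrix.cons_mul, h1, h2,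
        h3, h4]
    · intro f
      refine ⟨!![f (Matrix.single 1 1 1), -f (Matrix.single 1 0 1);
        -f (Matrix.single 0 1 1), f (Matrix.single 0 0 1)], ?_⟩
      refine Matrix.ext_linearMap ℤ fun i j => ?_
      ext
      fin_cases i <;> fin_cases j <;>
        simp [-zsmul_eq_mul, -zsmul_one, -Matrix.cons_mul, quatConj_apply, Matrix.trace,
          Matrix.mul_apply, Fin.sum_univ_two]

/-- The product of octonions, the pair `(a, b)` standing for `a + b v`:
`(a + b v) (c + d v) = (a c - d̄ b) + (d a + b c̄) v`. -/
def octMul : (Matrix (Fin 2) (Fin 2) ℤ × Matrix (Fin 2) (Fin 2) ℤ) →ₗ[ℤ]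
    (Matrix (Fin 2) (Fin 2) ℤ × Matrix (Fin 2) (Fin 2) ℤ) →ₗ[ℤ]
    (Matrix (Fin 2) (Fin 2) ℤ × Matrix (Fin 2) (Fin 2) ℤ) :=
  LinearMap.mk₂ ℤ
    (fun x y => (x.1 * y.1 - quatConj y.2 * x.2, y.2 * x.1 + x.2 * quatConj y.1))
    (by intro x x' y; ext1 <;> simp [-zsmul_eq_mul, -zsmul_one, -Matrix.cons_mul, mul_add,
      add_mul] <;> abel)
    (by intro k x y; simp [-zsmul_eq_mul, -zsmul_one, -Matrix.cons_mul, smul_sub])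
    (by intro x y y'; ext1 <;> simp [-zsmul_eq_mul, -zsmul_one, -Matrix.cons_mul, mul_add,
      add_mul] <;> abel)
    (by intro k x y; simp [-zsmul_eq_mul, -zsmul_one, -Matrix.cons_mul, smul_sub])

theorem octMul_apply (x y : Matrix (Fin 2) (Fin 2) ℤ × Matrix (Fin 2) (Fin 2) ℤ) :
    octMul x y =
      (x.1 * y.1 - quatConj y.2 * x.2, y.2 * x.1 + x.2 * quatConj y.1) := rfl

/-- The norm `det a + det b` of the octonion `a + b v`. -/
def octNorm : QuadraticForm ℤ (Matrix (Fin 2) (Fin 2) ℤ × Matrix (Fin 2) (Fin 2) ℤ) :=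
  quatNorm.prod quatNorm

theorem octNorm_apply (x : Matrix (Fin 2) (Fin 2) ℤ × Matrix (Fin 2) (Fin 2) ℤ) :
    octNorm x = quatNorm x.1 + quatNorm x.2 := rfl

/-- The conjugation `a + b v ↦ ā - b v` of octonions. -/
def octConj : (Matrix (Fin 2) (Fin 2) ℤ × Matrix (Fin 2) (Fin 2) ℤ) →ₗ[ℤ]
    (Matrix (Fin 2) (Fin 2) ℤ × Matrix (Fin 2) (Fin 2) ℤ) :=
  quatConj.prodMap (-LinearMap.id)

theorem octConj_apply (x : Matrix (Fin 2) (Fin 2) ℤ × Matrix (Fin 2) (Fin 2) ℤ) :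
    octConj x = (quatConj x.1, -x.2) := rfl

/-- The trace `a + b v ↦ tr a` of octonions. -/
def octTrace : (Matrix (Fin 2) (Fin 2) ℤ × Matrix (Fin 2) (Fin 2) ℤ) →ₗ[ℤ] ℤ :=
  (Matrix.traceLinearMap (Fin 2) ℤ ℤ).comp (LinearMap.fst ℤ _ _)

theorem octTrace_apply (x : Matrix (Fin 2) (Fin 2) ℤ × Matrix (Fin 2) (Fin 2) ℤ) :
    octTrace x = x.1.trace := rfl

set_option maxHeartbeats 2000000 in
/-- The integral split octonions. -/
def octonions :
    CompositionRing (Matrix (Fin 2) (Fin 2) ℤ × Matrix (Fin 2) (Fin 2) ℤ) where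
  mul := octMul
  one := (1, 0)
  conj := octConj
  trace := octTrace
  norm := octNorm
  one_mul x := by
    ext i j <;> fin_cases i <;> fin_cases j <;> simp [-zsmul_eq_mul, -zsmul_one,
      -Matrix.cons_mul, octMul_apply]
  mul_one x := by
    ext i j <;> fin_cases i <;> fin_cases j <;>
      simp [-zsmul_eq_mul, -zsmul_one, -Matrix.cons_mul, octMul_apply, quatConj_apply,
        Matrix.mul_apply, Fin.sum_univ_two]
  norm_mul x y := by
    simp [-zsmul_eq_mul, -zsmul_one, -Matrix.cons_mul, octMul_apply, octNorm_apply,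
      quatNorm_apply, quatConj_apply, Matrix.mul_apply,
      Fin.sum_univ_two]
    ring
  conj_conj x := by
    ext i j <;> fin_cases i <;> fin_cases j <;> simp [-zsmul_eq_mul, -zsmul_one,
      -Matrix.cons_mul, octConj_apply, quatConj_apply]
  conj_mul x y := by
    ext i j <;> fin_cases i <;> fin_cases j <;>
      simp [-zsmul_eq_mul, -zsmul_one, -Matrix.cons_mul, octMul_apply, octConj_apply,
        quatConj_apply, Matrix.mul_apply,
        Fin.sum_univ_two] <;> ring
  add_conj x := by
    ext i j <;> fin_cases i <;> fin_cases j <;>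
      simp [-zsmul_eq_mul, -zsmul_one, -Matrix.cons_mul, octTrace_apply, octConj_apply,
        quatConj_apply, Matrix.trace,
        Fin.sum_univ_two] <;> ring
  mul_conj x := by
    ext i j <;> fin_cases i <;> fin_cases j <;>
      simp [-zsmul_eq_mul, -zsmul_one, -Matrix.cons_mul, octMul_apply, octNorm_apply,
        quatNorm_apply, octConj_apply, quatConj_apply,
        Matrix.mul_apply, Fin.sum_univ_two] <;> ring
  norm_add x y := by
    simp [-zsmul_eq_mul, -zsmul_one, -Matrix.cons_mul, octMul_apply, octTrace_apply,
      octNorm_apply, quatNorm_apply, octConj_apply,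
      quatConj_apply, Matrix.mul_apply, Matrix.trace, Fin.sum_univ_two]
    ring
  norm_conj x := by
    simp [octConj_apply, octNorm_apply, quatConj_apply, quatNorm_apply]; ring
  trace_conj x := by
    simp [-zsmul_eq_mul, -zsmul_one, -Matrix.cons_mul, octTrace_apply, octConj_apply,
      quatConj_apply, Matrix.trace, Fin.sum_univ_two]
    ring
  trace_mul_comm x y := by
    simp [-zsmul_eq_mul, -zsmul_one, -Matrix.cons_mul, octMul_apply, octTrace_apply,
      quatConj_apply, Matrix.mul_apply, Matrix.trace,
      Fin.sum_univ_two]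
    ring
  trace_mul_assoc x y z := by
    simp [-zsmul_eq_mul, -zsmul_one, -Matrix.cons_mul, octMul_apply, octTrace_apply,
      quatConj_apply, Matrix.mul_apply, Matrix.trace,
      Fin.sum_univ_two]
    ring
  mul_mul_conj x y := by
    ext i j <;> fin_cases i <;> fin_cases j <;>
      simp [-zsmul_eq_mul, -zsmul_one, -Matrix.cons_mul, octMul_apply, octNorm_apply,
        quatNorm_apply, octConj_apply, quatConj_apply,
        Matrix.mul_apply, Fin.sum_univ_two] <;> ring
  conj_mul_mul x y := by
    ext i j <;> fin_cases i <;> fin_cases j <;>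
      simp [-zsmul_eq_mul, -zsmul_one, -Matrix.cons_mul, octMul_apply, octNorm_apply,
        quatNorm_apply, octConj_apply, quatConj_apply,
        Matrix.mul_apply, Fin.sum_univ_two] <;> ring
  moufang x y z := by
    ext i j <;> fin_cases i <;> fin_cases j <;>
      simp [-zsmul_eq_mul, -zsmul_one, -Matrix.cons_mul, octMul_apply, octTrace_apply,
        octNorm_apply, quatNorm_apply, octConj_apply,
        quatConj_apply, Matrix.mul_apply, Matrix.trace, Fin.sum_univ_two] <;> ring
  trace_form_bijective := by
    have key : ∀ x y : Matrix (Fin 2) (Fin 2) ℤ × Matrix (Fin 2) (Fin 2) ℤ,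
        octTrace (octMul x (octConj y)) = (x.1 * quatConj y.1).trace
          + (x.2 * quatConj y.2).trace := by
      intro x y
      simp [-zsmul_eq_mul, -zsmul_one, -Matrix.cons_mul, octMul_apply, octTrace_apply,
        octConj_apply, quatConj_apply, Matrix.mul_apply,
        Matrix.trace, Fin.sum_univ_two]
      ring
    constructor
    · intro a b h
      have ha := quaternions.trace_form_bijective.1
      ext1
      · refine ha (LinearMap.ext fun y => ?_)
        have := LinearMap.congr_fun h (y, 0)
        simp only [LinearMap.compr₂_apply, LinearMap.compl₁₂_apply, LinearMap.id_apply, key] at this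
        simpa [quaternions] using this
      · refine ha (LinearMap.ext fun y => ?_)
        have := LinearMap.congr_fun h (0, y)
        simp only [LinearMap.compr₂_apply, LinearMap.compl₁₂_apply, LinearMap.id_apply, key] at this
        simpa [quaternions] using this
    · intro f
      obtain ⟨a, ha⟩ := quaternions.trace_form_bijective.2 (f.comp (LinearMap.inl ℤ _ _))
      obtain ⟨b, hb⟩ := quaternions.trace_form_bijective.2 (f.comp (LinearMap.inr ℤ _ _))
      refine ⟨(a, b), LinearMap.ext fun y => ?_⟩
      have h1 := LinearMap.congr_fun ha y.1
      have h2 := LinearMap.congr_fun hb y.2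
      simp only [LinearMap.compr₂_apply, LinearMap.compl₁₂_apply, LinearMap.id_apply, key]
      have h3 : f y = f (y.1, 0) + f (0, y.2) := by rw [← map_add]; simp
      rw [h3]
      exact congrArg₂ (· + ·) h1 h2

/-! ### Hermitian matrices and the diagonal case -/

set_option maxHeartbeats 2000000 in
/-- The adjoint map of `H₃(C)`. -/
def hermSharp {C : Type} [AddCommGroup C] (K : CompositionRing C) :
    QuadraticMap ℤ ((Fin 3 → ℤ) × (Fin 3 → C)) ((Fin 3 → ℤ) × (Fin 3 → C)) :=
  QuadraticMap.ofPolar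
    (fun A =>
      (![A.1 1 * A.1 2 - K.norm (A.2 0), A.1 0 * A.1 2 - K.norm (A.2 1),
          A.1 0 * A.1 1 - K.norm (A.2 2)],
        ![K.conj (K.mul (A.2 1) (A.2 2)) - A.1 0 • A.2 0,
          K.conj (K.mul (A.2 2) (A.2 0)) - A.1 1 • A.2 1,
          K.conj (K.mul (A.2 0) (A.2 1)) - A.1 2 • A.2 2]))
    (by
      intro k A
      refine Prod.ext (funext fun i => ?_) (funext fun i => ?_) <;> fin_cases i
      iterate 3 simp [QuadraticMap.map_smul]; ring
      iterate 3 simp; module)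
    (by
      intro A B D
      refine Prod.ext (funext fun i => ?_) (funext fun i => ?_) <;> fin_cases i
      iterate 3 simp [QuadraticMap.polar, K.norm_add]; ring
      iterate 3 simp [QuadraticMap.polar, K.norm_add]; module)
    (by
      intro k A B
      refine Prod.ext (funext fun i => ?_) (funext fun i => ?_) <;> fin_cases i
      iterate 3 simp [QuadraticMap.polar, K.norm_add, QuadraticMap.map_smul]; ring
      iterate 3 simp [QuadraticMap.polar, K.norm_add, QuadraticMap.map_smul]; module)

theorem hermSharp_apply {C : Type} [AddCommGroup C] (K : CompositionRing C)
    (A : (Fin 3 → ℤ) × (Fin 3 → C)) :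
    hermSharp K A =
      (![A.1 1 * A.1 2 - K.norm (A.2 0), A.1 0 * A.1 2 - K.norm (A.2 1),
          A.1 0 * A.1 1 - K.norm (A.2 2)],
        ![K.conj (K.mul (A.2 1) (A.2 2)) - A.1 0 • A.2 0,
          K.conj (K.mul (A.2 2) (A.2 0)) - A.1 1 • A.2 1,
          K.conj (K.mul (A.2 0) (A.2 1)) - A.1 2 • A.2 2]) := rfl

/-- The norm of `H₃(C)`. -/
def hermNorm {C : Type} [AddCommGroup C] (K : CompositionRing C)
    (A : (Fin 3 → ℤ) × (Fin 3 → C)) : ℤ :=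
  A.1 0 * A.1 1 * A.1 2 - A.1 0 * K.norm (A.2 0) - A.1 1 * K.norm (A.2 1)
    - A.1 2 * K.norm (A.2 2) + K.trace (K.mul (K.mul (A.2 0) (A.2 1)) (A.2 2))

/-- The trace bilinear form of `H₃(C)`. -/
def hermForm {C : Type} [AddCommGroup C] (K : CompositionRing C) :
    LinearMap.BilinForm ℤ ((Fin 3 → ℤ) × (Fin 3 → C)) :=
  LinearMap.mk₂ ℤ
    (fun A B => ∑ i, A.1 i * B.1 i + ∑ i, K.trace (K.mul (A.2 i) (K.conj (B.2 i))))
    (by intro A A' B; simp [add_mul, Finset.sum_add_distrib]; ring)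
    (by intro k A B; simp [mul_add, Finset.mul_sum, mul_assoc])
    (by intro A B B'; simp [mul_add, Finset.sum_add_distrib]; ring)
    (by intro k A B; simp [mul_add, Finset.mul_sum, mul_left_comm])

theorem hermForm_apply {C : Type} [AddCommGroup C] (K : CompositionRing C)
    (A B : (Fin 3 → ℤ) × (Fin 3 → C)) :
    hermForm K A B =
      ∑ i, A.1 i * B.1 i + ∑ i, K.trace (K.mul (A.2 i) (K.conj (B.2 i))) := rfl

theorem CompositionRing.trace_mul_conj_comm {C : Type} [AddCommGroup C] (K : CompositionRing C)
    (x y : C) : K.trace (K.mul x (K.conj y)) = K.trace (K.mul y (K.conj x)) := by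
  rw [← K.trace_conj, K.conj_mul, K.conj_conj]

theorem CompositionRing.trace_conj_mul_conj {C : Type} [AddCommGroup C] (K : CompositionRing C)
    (x y : C) : K.trace (K.mul (K.conj x) (K.conj y)) = K.trace (K.mul x y) := by
  rw [← K.conj_mul, K.trace_conj, K.trace_mul_comm]

theorem CompositionRing.trace_cyc {C : Type} [AddCommGroup C] (K : CompositionRing C)
    (x y z : C) : K.trace (K.mul (K.mul x y) z) = K.trace (K.mul (K.mul y z) x) := by
  rw [K.trace_mul_assoc, K.trace_mul_comm]

theorem CompositionRing.trace_conj_mul_mul {C : Type} [AddCommGroup C] (K : CompositionRing C)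
    (x y z : C) : K.trace (K.mul (K.mul (K.conj x) (K.conj y)) (K.conj z)) =
      K.trace (K.mul (K.mul y x) z) := by
  rw [← K.conj_mul, K.trace_conj_mul_conj]

theorem CompositionRing.norm_sub {C : Type} [AddCommGroup C] (K : CompositionRing C)
    (x y : C) : K.norm (x - y) = K.norm x + K.norm y - K.trace (K.mul x (K.conj y)) := by
  rw [sub_eq_add_neg, K.norm_add]; simp; ring

/-- The norm is a cubic form whose linearization is given by the adjoint map. -/
theorem hermNorm_add {C : Type} [AddCommGroup C] (K : CompositionRing C)
    (A B : (Fin 3 → ℤ) × (Fin 3 → C)) :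
    hermNorm K (A + B) = hermNorm K A + hermForm K (hermSharp K A) B
      + hermForm K A (hermSharp K B) + hermNorm K B := by
  obtain ⟨a, x⟩ := A
  obtain ⟨b, y⟩ := B
  simp only [hermNorm, hermForm_apply, hermSharp_apply, Fin.sum_univ_three, Prod.fst_add,
    Prod.snd_add, Pi.add_apply, K.norm_add, Matrix.cons_val, map_add, map_sub, map_smul,
    LinearMap.add_apply, LinearMap.sub_apply, LinearMap.smul_apply, K.conj_conj,
    K.trace_conj_mul_conj, smul_eq_mul]
  rw [K.trace_cyc (y 0) (x 1) (x 2), K.trace_cyc (x 0) (y 1) (x 2),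
    K.trace_cyc (y 1) (x 2) (x 0), K.trace_cyc (x 0) (y 1) (y 2),
    K.trace_cyc (y 0) (x 1) (y 2), K.trace_cyc (x 1) (y 2) (y 0)]
  rw [K.trace_mul_conj_comm (x 0) (y 0), K.trace_mul_conj_comm (x 1) (y 1),
    K.trace_mul_conj_comm (x 2) (y 2)]
  rw [K.trace_mul_comm (x 0) (K.mul (y 1) (y 2)), K.trace_mul_comm (x 1) (K.mul (y 2) (y 0)),
    K.trace_mul_comm (x 2) (K.mul (y 0) (y 1))]
  ring

theorem hermSharp_sharp {C : Type} [AddCommGroup C] (K : CompositionRing C)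
    (A : (Fin 3 → ℤ) × (Fin 3 → C)) :
    hermSharp K (hermSharp K A) = hermNorm K A • A := by
  obtain ⟨a, x⟩ := A
  have h1 := K.trace_cyc (x 0) (x 1) (x 2)
  have h2 := K.trace_cyc (x 1) (x 2) (x 0)
  ext i
  · fin_cases i <;>
      simp [hermSharp_apply, hermNorm, K.norm_sub, K.norm_conj, K.norm_mul, QuadraticMap.map_smul,
        K.trace_conj_mul_conj, h1, h2] <;> ring
  · fin_cases i <;>
      simp [hermSharp_apply, hermNorm, K.conj_mul, K.conj_conj, K.mul_mul_conj,
        K.conj_mul_mul, K.moufang, K.norm_conj, K.trace_conj_mul_mul, h1, h2] <;> module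

theorem hermForm_bijective {C : Type} [AddCommGroup C] (K : CompositionRing C) :
    Function.Bijective (hermForm K) := by
  classical
  constructor
  · intro A B h
    ext i
    · simpa [hermForm_apply, Pi.single_apply] using LinearMap.congr_fun h (Pi.single i 1, 0)
    · refine K.trace_form_bijective.1 (LinearMap.ext fun y => ?_)
      have := LinearMap.congr_fun h (0, Pi.single i y)
      fin_cases i <;> simpa [hermForm_apply, Fin.sum_univ_three] using this
  · intro f
    choose g hg using fun i : Fin 3 => K.trace_form_bijective.2
      (f.comp ((LinearMap.inr ℤ (Fin 3 → ℤ) (Fin 3 → C)).comp (LinearMap.single ℤ (fun _ => C) i)))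
    refine ⟨(fun i => f (Pi.single i 1, 0), g), ?_⟩
    ext i
    · fin_cases i <;> simp [hermForm_apply, Fin.sum_univ_three]
    · have := LinearMap.congr_fun (hg i)
      fin_cases i <;> simpa [hermForm_apply, Fin.sum_univ_three] using this _

/-- The Jordan cubic `H₃(C)`. The pair `(a, x)` stands for the Hermitian matrix
`!![a 0, x 2, conj (x 1); conj (x 2), a 1, x 0; x 1, conj (x 0), a 2]` over `C`,
its norm being
`a₀ a₁ a₂ - a₀ n(x₀) - a₁ n(x₁) - a₂ n(x₂) + tr ((x₀ x₁) x₂)`. -/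
def hermitian {C : Type} [AddCommGroup C] (K : CompositionRing C) :
    JordanCubic ((Fin 3 → ℤ) × (Fin 3 → C)) where
  norm := hermNorm K
  one := (1, 0)
  form := hermForm K
  sharp := hermSharp K
  norm_smul k A := by simp [hermNorm, QuadraticMap.map_smul]; ring
  norm_add := hermNorm_add K
  norm_one := by simp [hermNorm]
  form_comm A B := by
    simp only [hermForm_apply, mul_comm (A.1 _), K.trace_mul_conj_comm (A.2 _)]
  form_eq A B := by
    simp [hermForm_apply, hermSharp_apply, Fin.sum_univ_three, K.norm_add]
    ring
  sharp_sharp := hermSharp_sharp K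
  form_bijective := hermForm_bijective K

/-- The Jordan cubic `ℤ ⊕ ℤ ⊕ ℤ` (the diagonal matrices), with norm `a₀ a₁ a₂`. -/
def diagonal : JordanCubic (Fin 3 → ℤ) where
  norm a := a 0 * a 1 * a 2
  one := 1
  form := dotProductBilin ℤ ℤ
  sharp := QuadraticMap.ofPolar (fun a => ![a 1 * a 2, a 0 * a 2, a 0 * a 1])
    (by intro k a; ext i; fin_cases i <;> simp <;> ring)
    (by intro a b c; ext i; fin_cases i <;> simp [QuadraticMap.polar] <;> ring)
    (by intro k a b; ext i; fin_cases i <;> simp [QuadraticMap.polar] <;> ring)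
  norm_smul k a := by simp; ring
  norm_add a b := by
    simp [QuadraticMap.ofPolar, dotProduct, Fin.sum_univ_three]; ring
  norm_one := by simp
  form_comm a b := dotProduct_comm a b
  form_eq a b := by
    simp [QuadraticMap.ofPolar, dotProduct, Fin.sum_univ_three]; ring
  sharp_sharp a := by
    ext i; fin_cases i <;> simp [QuadraticMap.ofPolar] <;> ring
  form_bijective := by
    classical
    constructor
    · intro a b h
      ext i
      simpa using LinearMap.congr_fun h (Pi.single i 1)
    · intro f
      refine ⟨fun i => f (Pi.single i 1), ?_⟩
      ext i
      simp

namespace JordanCubic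

/-! ### The Freudenthal construction -/

variable {J : Type} [AddCommGroup J] (X : JordanCubic J)

/-- The linearization `A × B = (A + B)♯ - A♯ - B♯` of the adjoint map. -/
def cross : LinearMap.BilinMap ℤ J J := X.sharp.polarBilin

theorem cross_apply (A B : J) : X.cross A B = X.sharp (A + B) - X.sharp A - X.sharp B := rfl

theorem sharp_add (A B : J) : X.sharp (A + B) = X.sharp A + X.sharp B + X.cross A B := by
  rw [cross_apply]; abel

theorem cross_comm (A B : J) : X.cross A B = X.cross B A := by
  rw [cross_apply, cross_apply, add_comm B A]; abel

theorem cross_self (A : J) : X.cross A A = (2 : ℤ) • X.sharp A := by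
  have h : A + A = (2 : ℤ) • A := (two_smul ℤ A).symm
  rw [cross_apply, h, X.sharp.map_smul]; module

theorem norm_neg (A : J) : X.norm (-A) = -X.norm A := by
  have h := X.norm_smul (-1) A
  simpa using h

theorem form_cross (A B C : J) : X.form (X.cross A B) C = X.form A (X.cross B C) := by
  have h1 := X.norm_add (A + B) C
  have h2 := X.norm_add A (B + C)
  rw [← add_assoc, h1, X.norm_add A B, X.norm_add B C] at h2
  simp only [sharp_add, map_add, LinearMap.add_apply] at h2
  linarith

theorem form_sharp_self (A : J) : X.form (X.sharp A) A = 3 * X.norm A := by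
  have h := X.norm_add A A
  have h2 := X.norm_smul 2 A
  rw [two_smul] at h2
  rw [h2, X.form_comm A] at h
  linarith

/-- The structure group: the `ℤ`-linear automorphisms that multiply the norm by a scalar. -/
def structureGroup : Subgroup (J ≃ₗ[ℤ] J) where
  carrier := {s | ∃ l : ℤ, ∀ A, X.norm (s A) = l * X.norm A}
  mul_mem' := by
    rintro s t ⟨l, hl⟩ ⟨m, hm⟩
    exact ⟨l * m, fun A => by rw [LinearEquiv.mul_apply, hl, hm, mul_assoc]⟩
  one_mem' := ⟨1, fun A => by simp⟩
  inv_mem' := by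
    rintro s ⟨l, hl⟩
    have key : ∀ A, X.norm A = l * X.norm (s.symm A) := fun A => by
      rw [← hl, LinearEquiv.apply_symm_apply]
    refine ⟨X.norm (s.symm X.one), fun A => ?_⟩
    have h1 := key X.one
    rw [X.norm_one] at h1
    change X.norm (s.symm A) = _
    rw [key A, ← mul_assoc, mul_comm _ l, ← h1, one_mul]

theorem exists_multiplier (s : X.structureGroup) :
    ∃ l : ℤˣ, ∀ A, X.norm ((s : J ≃ₗ[ℤ] J) A) = l * X.norm A := by
  obtain ⟨l, hl⟩ := s.2
  have h := hl ((s : J ≃ₗ[ℤ] J).symm X.one)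
  rw [LinearEquiv.apply_symm_apply, X.norm_one] at h
  exact ⟨Units.mkOfMulEqOne l _ h.symm, hl⟩

/-- The multiplier `λ = ±1` of a norm similarity `s`, i.e. `N(s A) = λ N(A)` for all `A`. -/
noncomputable def multiplier (s : X.structureGroup) : ℤˣ := (X.exists_multiplier s).choose

theorem multiplier_spec (s : X.structureGroup) (A : J) :
    X.norm ((s : J ≃ₗ[ℤ] J) A) = X.multiplier s * X.norm A :=
  (X.exists_multiplier s).choose_spec A

/-- The identification of `J` with its dual through the trace bilinear form. -/
noncomputable def toDual : J ≃ₗ[ℤ] Module.Dual ℤ J :=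
  LinearEquiv.ofBijective X.form X.form_bijective

/-- The adjoint `s^*` of `s` with respect to the trace bilinear form. -/
noncomputable def adjoint (s : J ≃ₗ[ℤ] J) : J ≃ₗ[ℤ] J :=
  (X.toDual.trans s.dualMap).trans X.toDual.symm

theorem form_adjoint (s : J ≃ₗ[ℤ] J) (A B : J) :
    X.form (s A) B = X.form A (X.adjoint s B) := by
  rw [X.form_comm (s A), X.form_comm A]
  have h : X.toDual (X.adjoint s B) = s.dualMap (X.toDual B) := by simp [adjoint]
  exact (LinearMap.congr_fun h A).symm

/-- The skew-symmetric form on `M(J) = ℤ ⊕ ℤ ⊕ J ⊕ J`; the quadruple `(α, β, A, B)` has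
components `x.1`, `x.2.1`, `x.2.2.1`, `x.2.2.2`. -/
def symplecticForm (x y : ℤ × ℤ × J × J) : ℤ :=
  x.1 * y.2.1 - x.2.1 * y.1 + X.form x.2.2.1 y.2.2.2 - X.form x.2.2.2 y.2.2.1

/-- The quartic form on `M(J)`. -/
def quarticForm (x : ℤ × ℤ × J × J) : ℤ :=
  8 * X.form (X.sharp x.2.2.1) (X.sharp x.2.2.2) - 8 * x.1 * X.norm x.2.2.1
    - 8 * x.2.1 * X.norm x.2.2.2 - 2 * (X.form x.2.2.1 x.2.2.2 - x.1 * x.2.1) ^ 2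

/-- The group of `ℤ`-linear automorphisms of `M(J)` preserving the two forms. -/
def freudenthalGroup : Subgroup ((ℤ × ℤ × J × J) ≃ₗ[ℤ] (ℤ × ℤ × J × J)) where
  carrier := {g | (∀ x y, X.symplecticForm (g x) (g y) = X.symplecticForm x y) ∧
    ∀ x, X.quarticForm (g x) = X.quarticForm x}
  mul_mem' := by
    rintro g h ⟨hg, hg'⟩ ⟨hh, hh'⟩
    exact ⟨fun x y => by simp only [LinearEquiv.mul_apply, hg, hh],
      fun x => by simp only [LinearEquiv.mul_apply, hg', hh']⟩
  one_mem' := ⟨fun _ _ => rfl, fun _ => rfl⟩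
  inv_mem' := by
    rintro g ⟨hg, hg'⟩
    refine ⟨fun x y => ?_, fun x => ?_⟩
    · have h := hg (g.symm x) (g.symm y)
      rw [LinearEquiv.apply_symm_apply, LinearEquiv.apply_symm_apply] at h
      exact h.symm
    · have h := hg' (g.symm x)
      rw [LinearEquiv.apply_symm_apply] at h
      exact h.symm

/-- The transformation `φ(C)` as a `ℤ`-linear map. -/
def phiMap (C : J) : (ℤ × ℤ × J × J) →ₗ[ℤ] (ℤ × ℤ × J × J) where
  toFun x :=
    (x.1 + X.form x.2.2.2 C + X.form x.2.2.1 (X.sharp C) + x.2.1 * X.norm C,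
      x.2.1,
      x.2.2.1 + x.2.1 • C,
      x.2.2.2 + X.cross x.2.2.1 C + x.2.1 • X.sharp C)
  map_add' x y := by
    ext <;> simp [add_smul] <;> first | ring | abel
  map_smul' k x := by
    ext <;> simp [mul_smul] <;> ring

/-- The transformation `ψ(D)` as a `ℤ`-linear map. -/
def psiMap (D : J) : (ℤ × ℤ × J × J) →ₗ[ℤ] (ℤ × ℤ × J × J) where
  toFun x :=
    (x.1,
      x.2.1 + X.form x.2.2.1 D + X.form x.2.2.2 (X.sharp D) + x.1 * X.norm D,
      x.2.2.1 + X.cross x.2.2.2 D + x.1 • X.sharp D,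
      x.2.2.2 + x.1 • D)
  map_add' x y := by
    ext <;> simp [add_smul] <;> first | ring | abel
  map_smul' k x := by
    ext <;> simp [mul_smul] <;> ring

theorem phiMap_neg_comp (C : J) (x : ℤ × ℤ × J × J) :
    X.phiMap (-C) (X.phiMap C x) = x := by
  obtain ⟨a, b, A, B⟩ := x
  have h1 : X.form (X.cross A C) C = 2 * X.form A (X.sharp C) := by
    rw [form_cross, cross_self]; simp
  have h2 := X.form_sharp_self C
  have h3 : X.form C (X.sharp C) = 3 * X.norm C := by rw [X.form_comm, h2]
  refine Prod.ext ?_ (Prod.ext ?_ (Prod.ext ?_ ?_))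
  · simp [phiMap, norm_neg, h1, h2, h3]; ring
  · simp [phiMap]
  · simp [phiMap]
  · simp [phiMap, cross_self]; module

theorem psiMap_neg_comp (D : J) (x : ℤ × ℤ × J × J) :
    X.psiMap (-D) (X.psiMap D x) = x := by
  obtain ⟨a, b, A, B⟩ := x
  have h1 : X.form (X.cross B D) D = 2 * X.form B (X.sharp D) := by
    rw [form_cross, cross_self]; simp
  have h2 := X.form_sharp_self D
  have h3 : X.form D (X.sharp D) = 3 * X.norm D := by rw [X.form_comm, h2]
  refine Prod.ext ?_ (Prod.ext ?_ (Prod.ext ?_ ?_))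
  · simp [psiMap]
  · simp [psiMap, norm_neg, h1, h2, h3]; ring
  · simp [psiMap, cross_self]; module
  · simp [psiMap]

/-- The elementary transformation `φ(C)`; its inverse is `φ(-C)`. -/
def phi (C : J) : (ℤ × ℤ × J × J) ≃ₗ[ℤ] (ℤ × ℤ × J × J) where
  __ := X.phiMap C
  invFun := X.phiMap (-C)
  left_inv := X.phiMap_neg_comp C
  right_inv x := by simpa using X.phiMap_neg_comp (-C) x

/-- The elementary transformation `ψ(D)`; its inverse is `ψ(-D)`. -/
def psi (D : J) : (ℤ × ℤ × J × J) ≃ₗ[ℤ] (ℤ × ℤ × J × J) where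
  __ := X.psiMap D
  invFun := X.psiMap (-D)
  left_inv := X.psiMap_neg_comp D
  right_inv x := by simpa using X.psiMap_neg_comp (-D) x

/-- The elementary transformation `T(s)`:
`(α, β, A, B) ↦ (λ⁻¹ α, λ β, s A, s^*⁻¹ B)`, where `λ` is the multiplier of `s`. -/
noncomputable def transT (s : X.structureGroup) :
    (ℤ × ℤ × J × J) ≃ₗ[ℤ] (ℤ × ℤ × J × J) :=
  (LinearEquiv.smulOfUnit (X.multiplier s)⁻¹).prodCongr
    ((LinearEquiv.smulOfUnit (X.multiplier s)).prodCongr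
      ((s : J ≃ₗ[ℤ] J).prodCongr (X.adjoint s).symm))

theorem transT_apply (s : X.structureGroup) (a b : ℤ) (A B : J) :
    X.transT s (a, b, A, B) =
      (((X.multiplier s)⁻¹ : ℤˣ) * a, (X.multiplier s : ℤ) * b,
        (s : J ≃ₗ[ℤ] J) A, (X.adjoint s).symm B) := rfl

/-- The elementary transformation `τ : (α, β, A, B) ↦ (-β, α, -B, A)`. -/
def tau (J : Type) [AddCommGroup J] : (ℤ × ℤ × J × J) ≃ₗ[ℤ] (ℤ × ℤ × J × J) where
  toFun x := (-x.2.1, x.1, -x.2.2.2, x.2.2.1)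
  map_add' x y := by ext <;> simp <;> abel
  map_smul' k x := by ext <;> simp
  invFun x := (x.2.1, -x.1, x.2.2.2, -x.2.2.1)
  left_inv x := by simp
  right_inv x := by simp

/-- The set of elementary transformations of `M(J)`. -/
def elementary : Set ((ℤ × ℤ × J × J) ≃ₗ[ℤ] (ℤ × ℤ × J × J)) :=
  Set.range X.phi ∪ Set.range X.psi ∪ Set.range X.transT ∪ {tau J}

end JordanCubic

namespace JordanCubic

variable {J : Type} [AddCommGroup J] (X : JordanCubic J)

/-! ### Identities in a Jordan cubic -/

/-! The argument works for any unimodular Jordan cubic spanned over the integers by its unimodular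
elements of rank one (`closure_elementary`); only this spanning property is checked case by case.

Write e = (1,0,0,0) and f = (0,1,0,0), and let g preserve both forms. Rank at most one is defined in
terms of q and the symplectic form alone, so g e inherits it from e. A Euclidean descent on the
first coordinate (`exists_natAbs_fst_lt`, `exists_eq_fst`) moves g e by elementary transformations
to (a,0,0,0). When the first coordinate a is nonzero of minimal size in the orbit, it divides (B,C)
for all unimodular rank one C, hence, by spanning and unimodularity, B itself. Some ψ then clears B,
and the rank condition clears the rest. Pairing with the image of f shows a = ±1, and τ² = -1
corrects the sign.

It remains to treat a g that fixes e. Since g f pairs to 1 with e, its second coordinate is 1, so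
some φ clears its J-coordinate A; the rank condition then makes it f (`mem_closure_of_fixes`). An
element fixing e and f preserves J ⊕ J and the norms of both components. Invariance of the norm
under a translation forces the translation to be zero (`eq_zero_of_norm_add`), so the element is
block diagonal, and the symplectic form identifies it as some T(s).

The converse inclusion needs q to be invariant. For φ this follows by completing the cube
(`sq_mul_quarticForm`), ψ is conjugate to φ under τ, and T(s) requires the behaviour of the adjoint
map under s and its dual. -/

theorem ext_form {A B : J} (h : ∀ Y, X.form A Y = X.form B Y) : A = B :=
  X.form_bijective.1 (LinearMap.ext h)

/-- The trace form embeds J in its integral dual, so J is torsion-free without this being assumed.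
-/
theorem eq_zero_of_smul (X : JordanCubic J) {k : ℤ} (hk : k ≠ 0) {A : J} (h : k • A = 0) : A = 0 := by
  refine X.ext_form fun Y => ?_
  have h1 := congrArg (fun Z => X.form Z Y) h
  simpa [hk] using h1

theorem sharp_neg (A : J) : X.sharp (-A) = X.sharp A := X.sharp.map_neg A

theorem sharp_smul (k : ℤ) (A : J) : X.sharp (k • A) = (k * k) • X.sharp A :=
  X.sharp.map_smul k A

theorem sharp_zero : X.sharp 0 = 0 := X.sharp.map_zero

theorem norm_zero : X.norm 0 = 0 := by
  simpa using X.norm_smul 0 0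

theorem norm_eq_zero_of_sharp {A : J} (h : X.sharp A = 0) : X.norm A = 0 := by
  have h1 := X.form_sharp_self A
  rw [h] at h1
  simp at h1
  exact h1

theorem form_self_sharp (A : J) : X.form A (X.sharp A) = 3 * X.norm A := by
  rw [X.form_comm, X.form_sharp_self]

theorem norm_sharp (A : J) : X.norm (X.sharp A) = X.norm A ^ 2 := by
  have h := X.form_sharp_self (X.sharp A)
  rw [X.sharp_sharp] at h
  simp only [map_smul, LinearMap.smul_apply, smul_eq_mul, X.form_self_sharp] at h
  linarith

theorem form_self_cross (A B : J) : X.form A (X.cross A B) = 2 * X.form (X.sharp A) B := by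
  rw [← X.form_cross, X.cross_self]
  simp

theorem form_cross_self (A B : J) : X.form (X.cross A B) B = 2 * X.form A (X.sharp B) := by
  rw [X.form_cross, X.cross_self]
  simp

/-- The coefficients of `t` and `t²` in `(A + t C)♯♯ = N(A + t C) (A + t C)`. -/
theorem form_cross_sharp_cross (A C Y : J) :
    X.form (X.cross (X.sharp A) (X.cross A C)) Y =
        X.norm A * X.form C Y + X.form (X.sharp A) C * X.form A Y ∧
      X.form (X.sharp (X.cross A C)) Y + X.form (X.cross (X.sharp A) (X.sharp C)) Y =
        X.form (X.sharp A) C * X.form C Y + X.form A (X.sharp C) * X.form A Y := by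
  have key : ∀ t : ℤ, _ := fun t => congrArg (fun Z => X.form Z Y) (X.sharp_sharp (A + t • C))
  simp only [X.sharp_add, X.norm_add, X.norm_smul, X.sharp_smul, X.sharp_sharp, map_add,
    map_smul, LinearMap.add_apply, LinearMap.smul_apply, smul_eq_mul,
    X.cross_comm (X.sharp C), smul_smul, smul_add] at key
  -- The terms of degree 0 and 4 in t have already cancelled by the adjoint identity for A and C;
  -- three nonzero values of t determine the coefficients of t, t² and t³.
  have h1 := key 1
  have h2 := key (-1)
  have h3 := key 2
  constructor <;> linarith

theorem cross_sharp_cross (A C : J) :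
    X.cross (X.sharp A) (X.cross A C) = X.norm A • C + X.form (X.sharp A) C • A :=
  X.ext_form fun Y => by simpa using (X.form_cross_sharp_cross A C Y).1

theorem form_sharp_sharp_cross (A C : J) :
    X.form (X.sharp A) (X.sharp (X.cross A C)) =
      X.form (X.sharp A) C ^ 2 + X.norm A * X.form A (X.sharp C) := by
  have h := (X.form_cross_sharp_cross A C (X.sharp A)).2
  rw [X.form_comm C, X.form_self_sharp, X.form_comm (X.sharp (X.cross A C)),
    X.cross_comm (X.sharp A), X.form_cross_self, X.sharp_sharp, map_smul, smul_eq_mul,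
    X.form_comm (X.sharp C)] at h
  linarith

/-- Comparing y with -y separates the part even in y, so z is orthogonal to every adjoint y♯, hence
to every cross product. The formula for the trace form in terms of the basepoint then makes z
orthogonal to all of J. -/
theorem eq_zero_of_norm_add {z : J} (h : ∀ y, X.norm (y + z) = X.norm y) : z = 0 := by
  have h0 : X.norm z = 0 := by
    have h1 := h 0
    rwa [zero_add, X.norm_zero] at h1
  have h1 : ∀ y, X.form (X.sharp y) z = 0 := fun y => by
    have h1 := h y
    have h2 := h (-y)
    rw [X.norm_add, h0] at h1 h2
    simp only [X.sharp_neg, map_neg, LinearMap.neg_apply] at h2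
    linarith
  refine X.ext_form fun w => ?_
  have h2 := X.form_eq z w
  have h3 := h1 (z + w)
  have h4 : X.form (X.cross z w) X.one = 0 := by
    rw [X.cross_comm, X.form_comm, ← X.form_cross, X.cross_apply]
    simp [h1]
  rw [← X.cross_apply, h4, h1] at h2
  simpa using h2

/-! ### The elementary transformations preserve the two forms -/

/-- This is the analogue of depressing a cubic: over the rationals φ(-A/b) removes A, and the two
expressions on the right are what remains, up to powers of b. Each is separately invariant under φ.
-/
theorem sq_mul_quarticForm (a b : ℤ) (A B : J) :
    b ^ 2 * X.quarticForm (a, b, A, B) =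
      -8 * X.norm (b • B - X.sharp A) -
        2 * (a * b ^ 2 - b * X.form A B + 2 * X.norm A) ^ 2 := by
  rw [sub_eq_add_neg (b • B), X.norm_add, X.norm_smul, X.norm_neg, X.norm_sharp, X.sharp_neg,
    X.sharp_smul, X.sharp_sharp]
  simp only [quarticForm, map_neg, map_smul, LinearMap.smul_apply, smul_eq_mul,
    X.form_comm B A, X.form_comm (X.sharp B)]
  ring

theorem phi_apply (C : J) (a b : ℤ) (A B : J) :
    X.phi C (a, b, A, B) =
      (a + X.form B C + X.form A (X.sharp C) + b * X.norm C, b, A + b • C,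
        B + X.cross A C + b • X.sharp C) := rfl

theorem psi_apply (D : J) (a b : ℤ) (A B : J) :
    X.psi D (a, b, A, B) =
      (a, b + X.form A D + X.form B (X.sharp D) + a * X.norm D,
        A + X.cross B D + a • X.sharp D, B + a • D) := rfl

theorem tau_apply (a b : ℤ) (A B : J) : tau J (a, b, A, B) = (-b, a, -B, A) := rfl

theorem quarticForm_phi (C : J) (x : ℤ × ℤ × J × J) :
    X.quarticForm (X.phi C x) = X.quarticForm x := by
  obtain ⟨a, b, A, B⟩ := x
  rw [X.phi_apply]
  rcases eq_or_ne b 0 with rfl | hb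
  -- For b = 0 the cube cannot be completed, and the invariance comes from the linearized adjoint
  -- identities.
  · have h1 : X.form (X.sharp A) (X.cross B (X.cross A C)) =
        X.norm A * X.form B C + X.form (X.sharp A) C * X.form A B := by
      rw [X.cross_comm B, ← X.form_cross, X.cross_sharp_cross]
      simp [X.form_comm C B]
    simp only [quarticForm, zero_smul, add_zero, X.sharp_add, map_add, h1,
      X.form_sharp_sharp_cross, X.form_self_cross]
    ring
  · refine mul_left_cancel₀ (pow_ne_zero 2 hb) ?_
    rw [X.sq_mul_quarticForm, X.sq_mul_quarticForm]
    have h1 : b • (B + X.cross A C + b • X.sharp C) - X.sharp (A + b • C) =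
        b • B - X.sharp A := by
      simp only [X.sharp_add, X.sharp_smul, map_smul]
      module
    have h2 : X.form C (X.cross A C) = 2 * X.form A (X.sharp C) := by
      rw [X.form_comm, X.form_cross_self]
    rw [h1, X.norm_add A, X.norm_smul, X.sharp_smul]
    simp only [map_add, map_smul, LinearMap.add_apply, LinearMap.smul_apply, smul_eq_mul,
      X.form_self_cross, h2, X.form_self_sharp, X.form_comm C B]
    ring

theorem symplecticForm_phi (C : J) (x y : ℤ × ℤ × J × J) :
    X.symplecticForm (X.phi C x) (X.phi C y) = X.symplecticForm x y := by
  obtain ⟨a, b, A, B⟩ := x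
  obtain ⟨a', b', A', B'⟩ := y
  have h1 : X.form (X.cross A C) A' = X.form A (X.cross A' C) := by
    rw [X.form_cross, X.cross_comm]
  have h2 : X.form C (X.cross A' C) = 2 * X.form A' (X.sharp C) := by
    rw [X.form_comm, X.form_cross_self]
  simp only [X.phi_apply, symplecticForm, map_add, map_smul, LinearMap.add_apply,
    LinearMap.smul_apply, smul_eq_mul, h1, h2, X.form_cross_self, X.form_self_sharp,
    X.form_sharp_self, X.form_comm C B', X.form_comm (X.sharp C) A']
  ring

theorem phi_mem (C : J) : X.phi C ∈ X.freudenthalGroup :=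
  ⟨X.symplecticForm_phi C, X.quarticForm_phi C⟩

theorem tau_mem : tau J ∈ X.freudenthalGroup := by
  constructor
  · rintro ⟨a, b, A, B⟩ ⟨a', b', A', B'⟩
    simp only [tau_apply, symplecticForm, map_neg, LinearMap.neg_apply]
    ring
  · rintro ⟨a, b, A, B⟩
    simp only [tau_apply, quarticForm, map_neg, LinearMap.neg_apply, X.sharp_neg, X.norm_neg,
      X.form_comm B A, X.form_comm (X.sharp B)]
    ring

/-- This transfers the invariance of both forms from φ to ψ without a second computation. -/
theorem psi_eq (D : J) : X.psi D = tau J * X.phi (-D) * (tau J)⁻¹ := by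
  rw [eq_mul_inv_iff_mul_eq]
  refine LinearEquiv.ext ?_
  rintro ⟨a, b, A, B⟩
  simp only [LinearEquiv.mul_apply, tau_apply, X.phi_apply, X.psi_apply, map_neg, X.sharp_neg,
    X.norm_neg, LinearMap.neg_apply]
  ext <;> simp <;> abel

theorem psi_mem (D : J) : X.psi D ∈ X.freudenthalGroup := by
  rw [X.psi_eq]
  exact mul_mem (mul_mem X.tau_mem (X.phi_mem _)) (inv_mem X.tau_mem)

/-! ### Norm similarities, their duals and the adjoint map -/

theorem form_adjoint_symm (s : J ≃ₗ[ℤ] J) (A B : J) :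
    X.form (s A) ((X.adjoint s).symm B) = X.form A B := by
  rw [X.form_adjoint, LinearEquiv.apply_symm_apply]

theorem form_adjoint_symm_left (s : J ≃ₗ[ℤ] J) (A B : J) :
    X.form ((X.adjoint s).symm A) (s B) = X.form A B := by
  rw [X.form_comm, X.form_adjoint_symm, X.form_comm]

theorem multiplier_mul_self (s : X.structureGroup) :
    (X.multiplier s : ℤ) * X.multiplier s = 1 := by
  rw [← Units.val_mul, Int.units_mul_self, Units.val_one]

/-- The adjoint is the derivative of the norm. Subtracting the expansions of N(s(A + B)) and N(s(A -
B)) isolates the terms odd in B, and nondegeneracy turns the resulting scalar identity into one in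
J. -/
theorem sharp_structure (s : X.structureGroup) (A : J) :
    X.sharp ((s : J ≃ₗ[ℤ] J) A) =
      (X.multiplier s : ℤ) • (X.adjoint (s : J ≃ₗ[ℤ] J)).symm (X.sharp A) := by
  have h : ∀ B, X.form (X.sharp ((s : J ≃ₗ[ℤ] J) A)) ((s : J ≃ₗ[ℤ] J) B) =
      X.multiplier s * X.form (X.sharp A) B := fun B => by
    have h1 := X.multiplier_spec s (A + B)
    have h2 := X.multiplier_spec s (A + -B)
    simp only [map_add, map_neg, X.norm_add, X.norm_neg, X.sharp_neg, X.multiplier_spec] at h1 h2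
    linarith
  refine X.ext_form fun Y => ?_
  obtain ⟨B, rfl⟩ := (s : J ≃ₗ[ℤ] J).surjective Y
  rw [h, map_smul, LinearMap.smul_apply, X.form_adjoint_symm_left, smul_eq_mul]

/-- Up to the factor N(B), B is itself an adjoint, namely of B♯. Applying `sharp_structure` to B♯
and taking adjoints once more gives the claim multiplied by N(B)², which can be cancelled. -/
theorem sharp_adjoint_symm_of_norm_ne_zero (s : X.structureGroup) {B : J} (hB : X.norm B ≠ 0) :
    X.sharp ((X.adjoint (s : J ≃ₗ[ℤ] J)).symm B) =
      (X.multiplier s : ℤ) • (s : J ≃ₗ[ℤ] J) (X.sharp B) := by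
  have h1 := X.sharp_structure s (X.sharp B)
  rw [X.sharp_sharp, map_smul] at h1
  have h2 := congrArg X.sharp h1
  rw [X.sharp_sharp, X.multiplier_spec, X.norm_sharp, X.sharp_smul, X.sharp_smul,
    X.multiplier_mul_self, one_smul] at h2
  rw [← sub_eq_zero]
  refine X.eq_zero_of_smul (mul_ne_zero hB hB) ?_
  rw [smul_sub, ← h2]
  module

/-- Every line parallel to the basepoint contains elements of nonzero norm. -/
theorem exists_norm_add_smul_one_ne_zero (B : J) :
    ∃ m : ℤ, ∀ t, m ≤ t → X.norm (B + t • X.one) ≠ 0 := by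
  -- N(B + t·1) is a monic cubic in t, so it has no root from one plus the sum of the absolute
  -- values of its lower coefficients onward.
  refine ⟨1 + |X.norm B| + |X.form (X.sharp B) X.one| + |X.form B (X.sharp X.one)|,
    fun t ht h => ?_⟩
  rw [X.norm_add, X.norm_smul, X.sharp_smul, X.norm_one] at h
  simp only [map_smul, smul_eq_mul] at h
  generalize X.norm B = d at *
  generalize X.form (X.sharp B) X.one = c at *
  generalize X.form B (X.sharp X.one) = b at *
  have hd := neg_abs_le d
  have hc := neg_abs_le c
  have hb := neg_abs_le b
  have hd' := abs_nonneg d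
  have hc' := abs_nonneg c
  have hb' := abs_nonneg b
  have h1 : 1 ≤ t := by linarith
  have h2 : t ≤ t * t := by nlinarith
  have h3 : -(|d| * (t * t)) ≤ d := by nlinarith
  have h4 : -(|c| * (t * t)) ≤ t * c := by nlinarith
  have h5 : -(|b| * (t * t)) ≤ t * t * b := by nlinarith
  have h6 : (1 + |d| + |c| + |b|) * (t * t) ≤ t * (t * t) :=
    mul_le_mul_of_nonneg_right ht (by positivity)
  nlinarith

/-- A density argument: both sides are quadratic in B, and the identity already holds at B + t·1 for
all large t. -/
theorem sharp_adjoint_symm (s : X.structureGroup) (B : J) :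
    X.sharp ((X.adjoint (s : J ≃ₗ[ℤ] J)).symm B) =
      (X.multiplier s : ℤ) • (s : J ≃ₗ[ℤ] J) (X.sharp B) := by
  obtain ⟨m, hm⟩ := X.exists_norm_add_smul_one_ne_zero B
  have key := fun t ht => X.sharp_adjoint_symm_of_norm_ne_zero s (hm t ht)
  have h1 := X.sharp_adjoint_symm_of_norm_ne_zero s (B := X.one) (by simp [X.norm_one])
  simp only [map_add, map_smul, X.sharp_add, X.sharp_smul, h1, smul_add] at key
  have h2 := key m le_rfl
  have h3 := key (m + 1) (by linarith)
  refine X.ext_form fun Y => ?_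
  have h4 := congrArg (fun Z => X.form Z Y) h2
  have h5 := congrArg (fun Z => X.form Z Y) h3
  simp only [map_add, map_smul, LinearMap.add_apply, LinearMap.smul_apply, smul_eq_mul] at h4 h5 ⊢
  -- The t² terms agree by the case B = 1, so the difference is affine in t; this combination of its
  -- values at m and m + 1 is its constant term.
  linear_combination (m + 1) * h4 - m * h5

theorem norm_adjoint_symm (s : X.structureGroup) (B : J) :
    X.norm ((X.adjoint (s : J ≃ₗ[ℤ] J)).symm B) = X.multiplier s * X.norm B := by
  have h := X.form_sharp_self ((X.adjoint (s : J ≃ₗ[ℤ] J)).symm B)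
  rw [X.sharp_adjoint_symm, map_smul, LinearMap.smul_apply, X.form_adjoint_symm,
    X.form_sharp_self, smul_eq_mul] at h
  linarith

theorem transT_mem (s : X.structureGroup) : X.transT s ∈ X.freudenthalGroup := by
  have hl := X.multiplier_mul_self s
  constructor
  · rintro ⟨a, b, A, B⟩ ⟨a', b', A', B'⟩
    simp only [X.transT_apply, symplecticForm, X.form_adjoint_symm, X.form_adjoint_symm_left,
      Int.units_inv_eq_self]
    linear_combination (a * b' - b * a') * hl
  · rintro ⟨a, b, A, B⟩
    simp only [X.transT_apply, quarticForm, X.form_adjoint_symm, X.sharp_structure,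
      X.sharp_adjoint_symm, X.norm_adjoint_symm, X.multiplier_spec, map_smul,
      LinearMap.smul_apply, smul_eq_mul, X.form_adjoint_symm_left, Int.units_inv_eq_self]
    have h2 : (X.multiplier s : ℤ) * a * (X.multiplier s * b) = a * b := by
      linear_combination (a * b) * hl
    rw [h2]
    linear_combination (8 * X.form (X.sharp A) (X.sharp B) - 8 * a * X.norm A
      - 8 * b * X.norm B) * hl

theorem elementary_subset : X.elementary ⊆ X.freudenthalGroup := by
  rintro _ (((⟨C, rfl⟩ | ⟨D, rfl⟩) | ⟨s, rfl⟩) | rfl)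
  exacts [X.phi_mem C, X.psi_mem D, X.transT_mem s, X.tau_mem]


/-! ### Elements of rank one -/

/-- The elements `x` of rank at most one: those for which `q(t x + y)` is a polynomial in `t` of
degree at most two with leading coefficient `-2 {x, y}²`. -/
def IsRankOne (x : ℤ × ℤ × J × J) : Prop :=
  ∀ y, ∃ c : ℤ, ∀ t : ℤ, X.quarticForm (t • x + y) =
    X.quarticForm y + t * c - 2 * t ^ 2 * X.symplecticForm x y ^ 2

variable {X}

/-- The rank condition mentions nothing but the two preserved forms, so its invariance is formal. -/
theorem IsRankOne.map {x : ℤ × ℤ × J × J} (hx : X.IsRankOne x)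
    {g : (ℤ × ℤ × J × J) ≃ₗ[ℤ] (ℤ × ℤ × J × J)} (hg : g ∈ X.freudenthalGroup) :
    X.IsRankOne (g x) := by
  intro y
  obtain ⟨y, rfl⟩ := g.surjective y
  obtain ⟨c, hc⟩ := hx y
  exact ⟨c, fun t => by rw [← map_smul, ← map_add, hg.2, hg.2, hg.1, hc]⟩

variable (X)

theorem isRankOne_one : X.IsRankOne (1, 0, 0, 0) := by
  rintro ⟨a, b, A, B⟩
  refine ⟨-8 * X.norm A + 4 * b * (X.form A B - a * b), fun t => ?_⟩
  simp [quarticForm, symplecticForm]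
  ring

variable {X}

/-- With y = 0 the condition makes q(t x) linear in t, whereas q is even. -/
theorem IsRankOne.quarticForm_eq_zero {x : ℤ × ℤ × J × J} (hx : X.IsRankOne x) :
    X.quarticForm x = 0 := by
  obtain ⟨c, hc⟩ := hx 0
  have h1 := hc 1
  have h2 := hc (-1)
  have h0 : X.quarticForm 0 = 0 := by simp [quarticForm, X.sharp_zero, X.norm_zero]
  have h4 : X.symplecticForm x 0 = 0 := by simp [symplecticForm]
  have h3 : X.quarticForm ((-1 : ℤ) • x) = X.quarticForm x := by
    simp [quarticForm, X.sharp_neg, X.norm_neg]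
  simp only [add_zero, h0, h4, h3, one_smul] at h1 h2
  linarith

theorem IsRankOne.eq_of_snd_eq_zero {a b : ℤ} {A : J} (ha : a ≠ 0)
    (h : X.IsRankOne (a, b, A, 0)) : b = 0 ∧ A = 0 := by
  have hq := h.quarticForm_eq_zero
  simp only [quarticForm, X.sharp_zero, X.norm_zero, map_zero] at hq
  -- Adding the rank conditions at t = 1 and t = -1 eliminates the unknown linear coefficient.
  -- Varying d below isolates a (A,D), which gives A = 0; then q = 0 gives b = 0.
  have key : ∀ (d : ℤ) (D : J), X.form (X.sharp A) (X.sharp D) + a * d * X.form A D = 0 := by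
    intro d D
    obtain ⟨c, hc⟩ := h (0, d, 0, D)
    have h1 := hc 1
    have h2 := hc (-1)
    simp only [quarticForm, symplecticForm, Prod.smul_mk, Prod.mk_add_mk, smul_eq_mul, add_zero,
      smul_zero, zero_add, X.sharp_smul, X.norm_smul, X.sharp_zero, X.norm_zero, map_zero,
      map_smul, LinearMap.smul_apply, LinearMap.zero_apply] at h1 h2
    linarith
  have hA : A = 0 := by
    refine X.ext_form fun D => ?_
    have h0 := key 0 D
    have h1 := key 1 D
    have h2 : a * X.form A D = 0 := by linarith
    simpa [ha] using h2
  subst hA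
  simp [X.norm_zero, ha] at hq
  exact ⟨hq, rfl⟩

theorem IsRankOne.eq_of_thd_eq_zero {a : ℤ} {B : J}
    (h : X.IsRankOne (a, 1, 0, B)) : a = 0 ∧ B = 0 := by
  have h1 := h.map (inv_mem X.tau_mem)
  have h2 : (tau J)⁻¹ (a, 1, 0, B) = (1, -a, B, 0) := by
    rw [LinearEquiv.coe_inv, LinearEquiv.symm_apply_eq]
    simp [tau_apply]
  rw [h2] at h1
  simpa using h1.eq_of_snd_eq_zero one_ne_zero

/-! ### Transitivity on primitive elements of rank one -/

variable (X)

/-- The elements of rank one in `J` that are unimodular. -/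
def rankOne : Set J := {C | X.sharp C = 0 ∧ ∃ D, X.form D C = 1}

variable {X}

theorem dvd_form_of_rankOne (h : Submodule.span ℤ X.rankOne = ⊤) {a : ℤ} {B : J}
    (hB : ∀ C ∈ X.rankOne, a ∣ X.form B C) (Y : J) : a ∣ X.form B Y := by
  have hY : Y ∈ Submodule.span ℤ X.rankOne := h ▸ Submodule.mem_top
  induction hY using Submodule.span_induction with
  | mem C hC => exact hB C hC
  | zero => simp
  | add C D _ _ hC hD => rw [map_add]; exact dvd_add hC hD
  | smul k C _ hC => rw [map_smul]; exact hC.mul_left k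

variable (X) in
-- The functional (B,·)/a is integral, so unimodularity represents it by an element of J.
theorem exists_eq_smul_of_dvd {a : ℤ} {B : J} (hB : ∀ Y, a ∣ X.form B Y) :
    ∃ D, B = a • D := by
  let f : J →ₗ[ℤ] ℤ :=
    { toFun := fun Y => X.form B Y / a
      map_add' := fun Y Z => by rw [map_add, Int.add_ediv_of_dvd_left (hB Y)]
      map_smul' := fun k Y => by
        rw [map_smul, smul_eq_mul, Int.mul_ediv_assoc _ (hB Y)]; rfl }
  obtain ⟨D, hD⟩ := X.form_bijective.2 f
  refine ⟨D, X.ext_form fun Y => ?_⟩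
  rw [map_smul, hD]
  exact (Int.mul_ediv_cancel' (hB Y)).symm

theorem phi_mem_closure (C : J) : X.phi C ∈ Subgroup.closure X.elementary :=
  Subgroup.subset_closure (Or.inl (Or.inl (Or.inl ⟨C, rfl⟩)))

theorem psi_mem_closure (D : J) : X.psi D ∈ Subgroup.closure X.elementary :=
  Subgroup.subset_closure (Or.inl (Or.inl (Or.inr ⟨D, rfl⟩)))

theorem transT_mem_closure (s : X.structureGroup) :
    X.transT s ∈ Subgroup.closure X.elementary :=
  Subgroup.subset_closure (Or.inl (Or.inr ⟨s, rfl⟩))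

theorem tau_mem_closure : tau J ∈ Subgroup.closure X.elementary :=
  Subgroup.subset_closure (Or.inr rfl)

/-- Rank one removes the quadratic and cubic terms of φ(kC), so the first coordinate moves along an
arithmetic progression. This is what permits division with remainder. -/
theorem phi_smul_apply_fst {C : J} (hC : X.sharp C = 0) (k a b : ℤ) (A B : J) :
    (X.phi (k • C) (a, b, A, B)).1 = a + k * X.form B C := by
  simp [X.phi_apply, X.sharp_smul, X.norm_smul, hC, X.norm_eq_zero_of_sharp hC]

theorem exists_fst_ne_zero (h : Submodule.span ℤ X.rankOne = ⊤) {x : ℤ × ℤ × J × J}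
    (hx : x ≠ 0) : ∃ g ∈ Subgroup.closure X.elementary, (g x).1 ≠ 0 := by
  have hB : ∀ (A B : J), B ≠ 0 →
      ∃ g ∈ Subgroup.closure X.elementary, (g (0, 0, A, B)).1 ≠ 0 := by
    intro A B hB
    -- Nonvanishing is phrased as non-divisibility by 0, so that the spanning lemma applies with a =
    -- 0.
    obtain ⟨C, hC, hC0⟩ : ∃ C ∈ X.rankOne, ¬ (0 : ℤ) ∣ X.form B C := by
      by_contra! hcon
      exact hB (X.ext_form fun Y => by
        simpa using zero_dvd_iff.1 (dvd_form_of_rankOne h hcon Y))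
    refine ⟨X.phi ((1 : ℤ) • C), phi_mem_closure _, ?_⟩
    rw [phi_smul_apply_fst hC.1]
    simpa using hC0
  obtain ⟨a, b, A, B⟩ := x
  by_cases ha : a = 0
  · subst ha
    by_cases hb : b = 0
    · subst hb
      by_cases hB0 : B = 0
      · subst hB0
        have hA : A ≠ 0 := by rintro rfl; exact hx rfl
        obtain ⟨g, hg, hg0⟩ := hB (-0) A hA
        refine ⟨g * tau J, mul_mem hg tau_mem_closure, ?_⟩
        rw [LinearEquiv.mul_apply, tau_apply]
        simpa using hg0
      · exact hB A B hB0
    · exact ⟨tau J, tau_mem_closure, by simpa [tau_apply] using hb⟩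
  · exact ⟨1, one_mem _, ha⟩

/-- One round of the Euclidean algorithm on a and (B,C): since (D,C) = 1, a multiple of D in ψ
reduces (B,C) modulo a, and then φ(kC) reduces a modulo the remainder r. -/
theorem exists_natAbs_fst_lt {C : J} (hC : C ∈ X.rankOne) {a b : ℤ} {A B : J} (ha : a ≠ 0)
    (hB : ¬ a ∣ X.form B C) :
    ∃ g ∈ Subgroup.closure X.elementary, (g (a, b, A, B)).1 ≠ 0 ∧
      (g (a, b, A, B)).1.natAbs < a.natAbs := by
  obtain ⟨hC0, D, hD⟩ := hC
  set r := X.form B C % a with hr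
  have hr0 : 0 < r := lt_of_le_of_ne (Int.emod_nonneg _ ha)
    fun h0 => hB (Int.dvd_of_emod_eq_zero h0.symm)
  have hra : r < |a| := Int.emod_lt_abs _ ha
  rw [Int.abs_eq_natAbs] at hra
  have hform : X.form (B + a • ((-(X.form B C / a)) • D)) C = r := by
    have h1 := Int.emod_add_mul_ediv (X.form B C) a
    simp only [map_add, map_smul, LinearMap.add_apply, LinearMap.smul_apply, smul_eq_mul, hD]
    linarith
  have key : ∀ k : ℤ, ∃ g ∈ Subgroup.closure X.elementary,
      (g (a, b, A, B)).1 = a + k * r := fun k =>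
    ⟨X.phi (k • C) * X.psi ((-(X.form B C / a)) • D),
      mul_mem (phi_mem_closure _) (psi_mem_closure _), by
        rw [LinearEquiv.mul_apply, X.psi_apply, phi_smul_apply_fst hC0, hform]⟩
  have h2 := Int.emod_add_mul_ediv a r
  by_cases hs : a % r = 0
  -- If r divides a, full reduction would reach the forbidden value 0; stopping one step earlier
  -- leaves r, which is still smaller than |a|.
  · obtain ⟨g, hg, hg1⟩ := key (1 - a / r)
    have h3 : (g (a, b, A, B)).1 = r := by rw [hg1]; linarith
    rw [← h3] at hr0 hra
    exact ⟨g, hg, hr0.ne', by omega⟩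
  · obtain ⟨g, hg, hg1⟩ := key (-(a / r))
    have h3 : (g (a, b, A, B)).1 = a % r := by rw [hg1]; linarith
    have h4 := Int.emod_nonneg a hr0.ne'
    have h5 := Int.emod_lt_of_pos a hr0
    rw [← h3] at hs h4 h5
    exact ⟨g, hg, hs, by omega⟩

theorem exists_eq_fst (h : Submodule.span ℤ X.rankOne = ⊤) {x : ℤ × ℤ × J × J}
    (hx : X.IsRankOne x) (hx0 : x ≠ 0) :
    ∃ g ∈ Subgroup.closure X.elementary, ∃ a : ℤ, g x = (a, 0, 0, 0) := by
  have hsub : Subgroup.closure X.elementary ≤ X.freudenthalGroup :=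
    (Subgroup.closure_le _).2 X.elementary_subset
  have hex : ∃ n : ℕ, ∃ g ∈ Subgroup.closure X.elementary,
      (g x).1 ≠ 0 ∧ (g x).1.natAbs = n := by
    obtain ⟨g, hg, hg0⟩ := exists_fst_ne_zero h hx0
    exact ⟨_, g, hg, hg0, rfl⟩
  classical
  obtain ⟨g, hg, hg0, hgn⟩ := Nat.find_spec hex
  have hmin := fun m => Nat.find_min hex (m := m)
  rw [← hgn] at hmin
  obtain ⟨⟨a, b, A, B⟩, hgx⟩ : ∃ y, y = g x := ⟨_, rfl⟩
  have hrank := hx.map (hsub hg)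
  rw [← hgx] at hrank
  have hga : (g x).1 = a := by rw [← hgx]
  rw [hga] at hg0 hmin
  have hdvd : ∀ C ∈ X.rankOne, a ∣ X.form B C := by
    intro C hC
    by_contra hcon
    obtain ⟨g', hg', h1, h2⟩ := exists_natAbs_fst_lt (b := b) (A := A) hC hg0 hcon
    rw [hgx] at h1 h2
    exact hmin _ h2 ⟨g' * g, mul_mem hg' hg, h1, rfl⟩
  obtain ⟨D, rfl⟩ := X.exists_eq_smul_of_dvd (dvd_form_of_rankOne h hdvd)
  refine ⟨X.psi (-D) * g, mul_mem (psi_mem_closure _) hg, a, ?_⟩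
  have h1 := hrank.map (X.psi_mem (-D))
  rw [LinearEquiv.mul_apply, ← hgx]
  rw [X.psi_apply, smul_neg, add_neg_cancel] at h1 ⊢
  obtain ⟨h2, h3⟩ := h1.eq_of_snd_eq_zero hg0
  rw [h2, h3]

/-! ### The stabilizer of the two basepoints -/

variable (X) in
theorem symplecticForm_fst (x : ℤ × ℤ × J × J) :
    X.symplecticForm (1, 0, 0, 0) x = x.2.1 := by
  simp [symplecticForm]

variable (X) in
theorem symplecticForm_snd (x : ℤ × ℤ × J × J) :
    X.symplecticForm (0, 1, 0, 0) x = -x.1 := by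
  simp [symplecticForm]

section Stabilizer

variable {g : (ℤ × ℤ × J × J) ≃ₗ[ℤ] (ℤ × ℤ × J × J)}

/-- Pairing with the two basepoints kills the scalar coordinates. Adding a basepoint to (0,0,A,B)
changes q by -8N(A) or -8N(B), so each norm is preserved separately. -/
theorem exists_apply_of_fixes (hg : g ∈ X.freudenthalGroup) (he : g (1, 0, 0, 0) = (1, 0, 0, 0))
    (hf : g (0, 1, 0, 0) = (0, 1, 0, 0)) (A B : J) :
    ∃ A' B', g (0, 0, A, B) = (0, 0, A', B') ∧ X.norm A' = X.norm A ∧ X.norm B' = X.norm B := by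
  obtain ⟨⟨a, b, A', B'⟩, hx⟩ : ∃ y, y = g (0, 0, A, B) := ⟨_, rfl⟩
  have h1 := hg.1 (1, 0, 0, 0) (0, 0, A, B)
  have h2 := hg.1 (0, 1, 0, 0) (0, 0, A, B)
  rw [he, ← hx, X.symplecticForm_fst, X.symplecticForm_fst] at h1
  rw [hf, ← hx, X.symplecticForm_snd, X.symplecticForm_snd] at h2
  simp only [neg_zero, neg_eq_zero] at h1 h2
  subst h1 h2
  have h3 := hg.2 (0, 0, A, B)
  have h4 := hg.2 ((1, 0, 0, 0) + (0, 0, A, B))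
  have h5 := hg.2 ((0, 1, 0, 0) + (0, 0, A, B))
  rw [← hx] at h3
  rw [map_add, he, ← hx] at h4
  rw [map_add, hf, ← hx] at h5
  simp [quarticForm] at h3 h4 h5
  exact ⟨A', B', hx.symm, by linarith, by linarith⟩

theorem apply_inl_of_fixes (hg : g ∈ X.freudenthalGroup)
    (he : g (1, 0, 0, 0) = (1, 0, 0, 0)) (hf : g (0, 1, 0, 0) = (0, 1, 0, 0)) (A : J) :
    ∃ A', g (0, 0, A, 0) = (0, 0, A', 0) := by
  have he' : g⁻¹ (1, 0, 0, 0) = (1, 0, 0, 0) := by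
    rw [LinearEquiv.coe_inv, LinearEquiv.symm_apply_eq, he]
  have hf' : g⁻¹ (0, 1, 0, 0) = (0, 1, 0, 0) := by
    rw [LinearEquiv.coe_inv, LinearEquiv.symm_apply_eq, hf]
  obtain ⟨A', B', h1, -, -⟩ := exists_apply_of_fixes hg he hf A 0
  have hB : B' = 0 := by
    refine X.eq_zero_of_norm_add fun y => ?_
    -- Pull (0,0,0,y) back to (0,0,A₀,B₀). Adding A to A₀ does not affect the norm of the last
    -- component, but shifts its image y by B'; hence N(y + B') = N(y).
    obtain ⟨A₀, B₀, h2, -, h3⟩ := exists_apply_of_fixes (inv_mem hg) he' hf' 0 y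
    rw [LinearEquiv.coe_inv, LinearEquiv.symm_apply_eq] at h2
    obtain ⟨A₁, B₁, h4, -, h5⟩ := exists_apply_of_fixes hg he hf (A₀ + A) B₀
    have h6 : ((0, 0, A₀ + A, B₀) : ℤ × ℤ × J × J) = (0, 0, A₀, B₀) + (0, 0, A, 0) := by simp
    rw [h6, map_add, ← h2, h1] at h4
    simp only [Prod.mk_add_mk, Prod.mk.injEq] at h4
    rw [h4.2.2.2, h5, h3]
  exact ⟨A', by rw [h1, hB]⟩

theorem apply_inr_of_fixes (hg : g ∈ X.freudenthalGroup)
    (he : g (1, 0, 0, 0) = (1, 0, 0, 0)) (hf : g (0, 1, 0, 0) = (0, 1, 0, 0)) (B : J) :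
    ∃ B', g (0, 0, 0, B) = (0, 0, 0, B') := by
  have he' : g⁻¹ (1, 0, 0, 0) = (1, 0, 0, 0) := by
    rw [LinearEquiv.coe_inv, LinearEquiv.symm_apply_eq, he]
  have hf' : g⁻¹ (0, 1, 0, 0) = (0, 1, 0, 0) := by
    rw [LinearEquiv.coe_inv, LinearEquiv.symm_apply_eq, hf]
  obtain ⟨A', B', h1, -, -⟩ := exists_apply_of_fixes hg he hf 0 B
  have hA : A' = 0 := by
    refine X.eq_zero_of_norm_add fun y => ?_
    obtain ⟨A₀, B₀, h2, h3, -⟩ := exists_apply_of_fixes (inv_mem hg) he' hf' y 0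
    rw [LinearEquiv.coe_inv, LinearEquiv.symm_apply_eq] at h2
    obtain ⟨A₁, B₁, h4, h5, -⟩ := exists_apply_of_fixes hg he hf A₀ (B₀ + B)
    have h6 : ((0, 0, A₀, B₀ + B) : ℤ × ℤ × J × J) = (0, 0, A₀, B₀) + (0, 0, 0, B) := by simp
    rw [h6, map_add, ← h2, h1] at h4
    simp only [Prod.mk_add_mk, Prod.mk.injEq] at h4
    rw [h4.2.2.1, h5, h3]
  exact ⟨B', by rw [h1, hA]⟩

/-- The block on the first copy of J preserves the norm and serves as s, with multiplier 1;
invariance of the symplectic form leaves the inverse dual of s as the only choice for the other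
block. -/
theorem exists_eq_transT_of_fixes (hg : g ∈ X.freudenthalGroup)
    (he : g (1, 0, 0, 0) = (1, 0, 0, 0)) (hf : g (0, 1, 0, 0) = (0, 1, 0, 0)) :
    ∃ s, g = X.transT s := by
  have he' : g⁻¹ (1, 0, 0, 0) = (1, 0, 0, 0) := by
    rw [LinearEquiv.coe_inv, LinearEquiv.symm_apply_eq, he]
  have hf' : g⁻¹ (0, 1, 0, 0) = (0, 1, 0, 0) := by
    rw [LinearEquiv.coe_inv, LinearEquiv.symm_apply_eq, hf]
  choose p hp using apply_inl_of_fixes hg he hf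
  choose p' hp' using apply_inl_of_fixes (inv_mem hg) he' hf'
  choose t ht using apply_inr_of_fixes hg he hf
  simp only [LinearEquiv.coe_inv, LinearEquiv.symm_apply_eq] at hp'
  have hinj : ∀ {A B : J}, ((0, 0, A, 0) : ℤ × ℤ × J × J) = (0, 0, B, 0) → A = B := by
    intro A B h
    simpa using h
  let s : J ≃ₗ[ℤ] J :=
    { toFun := p
      map_add' := fun A B => hinj (by
        rw [← hp, show ((0, 0, A + B, 0) : ℤ × ℤ × J × J) = (0, 0, A, 0) + (0, 0, B, 0) by simp,
          map_add, hp, hp]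
        simp)
      map_smul' := fun k A => hinj (by
        rw [← hp, show ((0, 0, k • A, 0) : ℤ × ℤ × J × J) = k • (0, 0, A, 0) by simp,
          map_smul, hp]
        simp)
      invFun := p'
      left_inv := fun A => hinj (g.injective (by rw [← hp', hp]))
      right_inv := fun A => hinj (by rw [← hp, ← hp']) }
  have hnorm : ∀ A, X.norm (s A) = X.norm A := fun A => by
    obtain ⟨A', B', h1, h2, -⟩ := exists_apply_of_fixes hg he hf A 0
    rw [hp] at h1
    simp only [Prod.mk.injEq] at h1
    rw [← h2, ← h1.2.2.1]
    rfl
  let s' : X.structureGroup := ⟨s, 1, fun A => by rw [one_mul, hnorm]⟩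
  have hmul : X.multiplier s' = 1 := by
    have h1 := X.multiplier_spec s' X.one
    rw [hnorm, X.norm_one, mul_one] at h1
    exact Units.ext h1.symm
  have hadj : ∀ B, t B = (X.adjoint s).symm B := fun B => by
    rw [LinearEquiv.eq_symm_apply]
    refine X.ext_form fun A => ?_
    have h1 := hg.1 (0, 0, A, 0) (0, 0, 0, B)
    rw [hp, ht] at h1
    simp only [symplecticForm, map_zero, mul_zero, sub_zero, zero_add] at h1
    rw [X.form_comm, ← X.form_adjoint, X.form_comm B]
    exact h1
  refine ⟨s', LinearEquiv.ext ?_⟩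
  rintro ⟨a, b, A, B⟩
  have h1 : ((a, b, A, B) : ℤ × ℤ × J × J) =
      a • (1, 0, 0, 0) + b • (0, 1, 0, 0) + (0, 0, A, 0) + (0, 0, 0, B) := by simp
  conv_lhs => rw [h1]
  rw [map_add, map_add, map_add, map_smul, map_smul, he, hf, hp, ht, X.transT_apply, hmul, hadj]
  simp [s', s]

end Stabilizer

/-- The image of (0,1,0,0) has second coordinate 1, so φ(-C) clears its third coordinate C while
fixing (1,0,0,0); the rank condition then returns the image to (0,1,0,0). -/
theorem mem_closure_of_fixes {g : (ℤ × ℤ × J × J) ≃ₗ[ℤ] (ℤ × ℤ × J × J)}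
    (hg : g ∈ X.freudenthalGroup) (he : g (1, 0, 0, 0) = (1, 0, 0, 0)) :
    g ∈ Subgroup.closure X.elementary := by
  obtain ⟨⟨a, b, C, D⟩, hx⟩ : ∃ y, y = g (0, 1, 0, 0) := ⟨_, rfl⟩
  have hrank : X.IsRankOne (0, 1, 0, 0) := by
    simpa [tau_apply] using X.isRankOne_one.map X.tau_mem
  have hb := hg.1 (1, 0, 0, 0) (0, 1, 0, 0)
  rw [he, ← hx, X.symplecticForm_fst, X.symplecticForm_fst] at hb
  simp only at hb
  subst hb
  have h1 := (hrank.map hg).map (X.phi_mem (-C))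
  rw [← hx, X.phi_apply, one_smul, add_neg_cancel] at h1
  obtain ⟨h2, h3⟩ := h1.eq_of_thd_eq_zero
  have h4 : X.phi (-C) * g ∈ X.freudenthalGroup := mul_mem (X.phi_mem _) hg
  obtain ⟨s, hs⟩ := exists_eq_transT_of_fixes h4
    (by rw [LinearEquiv.mul_apply, he, X.phi_apply]; simp)
    (by rw [LinearEquiv.mul_apply, ← hx, X.phi_apply, one_smul, add_neg_cancel, h2, h3])
  rw [← inv_mul_cancel_left (X.phi (-C)) g, hs]
  exact mul_mem (inv_mem (phi_mem_closure _)) (transT_mem_closure s)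

/-- The Freudenthal group of a Jordan cubic spanned by its unimodular elements of rank one is
generated by the elementary transformations. -/
theorem closure_elementary (h : Submodule.span ℤ X.rankOne = ⊤) :
    Subgroup.closure X.elementary = X.freudenthalGroup := by
  have hsub : Subgroup.closure X.elementary ≤ X.freudenthalGroup :=
    (Subgroup.closure_le _).2 X.elementary_subset
  refine le_antisymm hsub fun g hg => ?_
  obtain ⟨k, hk, a, hka⟩ := exists_eq_fst h (X.isRankOne_one.map hg)
    (by rw [Ne, map_eq_zero_iff _ g.injective]; simp)
  -- The images of the two basepoints still pair to 1, and this pairing is a multiple of a.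
  have ha : IsUnit a := by
    have h1 := (mul_mem (hsub hk) hg).1 (1, 0, 0, 0) (0, 1, 0, 0)
    rw [LinearEquiv.mul_apply, hka] at h1
    simp [symplecticForm] at h1
    exact IsUnit.of_mul_eq_one _ h1
  have hneg : ((tau J) ^ 2 : (ℤ × ℤ × J × J) ≃ₗ[ℤ] (ℤ × ℤ × J × J)) (-1, 0, 0, 0) =
      (1, 0, 0, 0) := by
    rw [pow_two, LinearEquiv.mul_apply, tau_apply, tau_apply]
    simp
  obtain ⟨k', hk', hk1⟩ : ∃ k' ∈ Subgroup.closure X.elementary,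
      (k' * g) (1, 0, 0, 0) = (1, 0, 0, 0) := by
    rcases Int.isUnit_iff.1 ha with rfl | rfl
    · exact ⟨k, hk, hka⟩
    · exact ⟨tau J ^ 2 * k, mul_mem (pow_mem tau_mem_closure 2) hk, by
        rw [mul_assoc, LinearEquiv.mul_apply, LinearEquiv.mul_apply, hka, hneg]⟩
  exact (Subgroup.mul_mem_cancel_left _ hk').1
    (mem_closure_of_fixes (mul_mem (hsub hk') hg) hk1)

end JordanCubic

/-! ### Spanning by unimodular elements of rank one -/

namespace CompositionRing

variable {C : Type} [AddCommGroup C] (K : CompositionRing C)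

/-- The isotropic unimodular elements of a composition ring. -/
def isotropic : Set C := {x | K.norm x = 0 ∧ ∃ y, K.trace (K.mul y (K.conj x)) = 1}

/-- Each entry of the adjoint is built from products of two distinct entries and norms of single
off-diagonal entries. Hence a matrix with one diagonal 1, or with one isotropic off-diagonal entry
and its conjugate, has adjoint zero. -/
theorem span_rankOne (h : Submodule.span ℤ K.isotropic = ⊤) :
    Submodule.span ℤ (hermitian K).rankOne = ⊤ := by
  have h1 : ∀ (a : ℤ) (i : Fin 3), ((Pi.single i a, 0) : (Fin 3 → ℤ) × (Fin 3 → C)) ∈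
      Submodule.span ℤ (hermitian K).rankOne := by
    intro a i
    have h2 : ((Pi.single i a, 0) : (Fin 3 → ℤ) × (Fin 3 → C)) = a • (Pi.single i 1, 0) := by
      ext j
      · simp [Pi.single_apply]
      · simp
    rw [h2]
    refine Submodule.smul_mem _ _ (Submodule.subset_span ⟨?_, (Pi.single i 1, 0), ?_⟩)
    · change hermSharp K _ = 0
      rw [hermSharp_apply]
      ext j <;> fin_cases i <;> fin_cases j <;> simp
    · change hermForm K _ _ = 1
      rw [hermForm_apply]
      fin_cases i <;> simp [Fin.sum_univ_three]
  have h2 : ∀ (x : C) (i : Fin 3), ((0, Pi.single i x) : (Fin 3 → ℤ) × (Fin 3 → C)) ∈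
      Submodule.span ℤ (hermitian K).rankOne := by
    intro x i
    have hx : x ∈ Submodule.span ℤ K.isotropic := h ▸ Submodule.mem_top
    let f : C →ₗ[ℤ] (Fin 3 → ℤ) × (Fin 3 → C) :=
      (LinearMap.inr ℤ (Fin 3 → ℤ) (Fin 3 → C)).comp (LinearMap.single ℤ (fun _ => C) i)
    have h3 : K.isotropic ⊆ (Submodule.span ℤ (hermitian K).rankOne).comap f := by
      rintro y ⟨hy, z, hz⟩
      refine Submodule.subset_span ⟨?_, (0, Pi.single i z), ?_⟩
      · change hermSharp K (0, Pi.single i y) = 0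
        rw [hermSharp_apply]
        ext j <;> fin_cases i <;> fin_cases j <;> simp [hy]
      · change hermForm K (0, Pi.single i z) (0, Pi.single i y) = 1
        rw [hermForm_apply]
        fin_cases i <;> simp [Fin.sum_univ_three, hz]
    exact Submodule.span_le.2 h3 hx
  rw [eq_top_iff]
  rintro ⟨a, x⟩ -
  have h3 : ((a, x) : (Fin 3 → ℤ) × (Fin 3 → C)) =
      ∑ i, (Pi.single i (a i), 0) + ∑ i, (0, Pi.single i (x i)) := by
    ext j
    · fin_cases j <;> simp [Fin.sum_univ_three]
    · fin_cases j <;> simp [Fin.sum_univ_three]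
  rw [h3]
  exact add_mem (Submodule.sum_mem _ fun i _ => h1 _ i) (Submodule.sum_mem _ fun i _ => h2 _ i)

end CompositionRing

/-! ### Spanning in the four cases -/

theorem binarions_span_isotropic : Submodule.span ℤ binarions.isotropic = ⊤ := by
  rw [eq_top_iff]
  rintro ⟨a, b⟩ -
  have h : ((a, b) : ℤ × ℤ) = a • (1, 0) + b • (0, 1) := by simp
  rw [h]
  refine add_mem (Submodule.smul_mem _ _ (Submodule.subset_span ⟨?_, (0, 1), ?_⟩))
    (Submodule.smul_mem _ _ (Submodule.subset_span ⟨?_, (1, 0), ?_⟩)) <;>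
  simp [binarions, QuadraticMap.ofPolar]

theorem quatNorm_single (i j : Fin 2) : quatNorm (Matrix.single i j 1) = 0 := by
  fin_cases i <;> fin_cases j <;> simp [quatNorm_apply]

theorem exists_trace_mul_quatConj_single (i j : Fin 2) :
    ∃ y : Matrix (Fin 2) (Fin 2) ℤ, (y * quatConj (Matrix.single i j 1)).trace = 1 := by
  -- Unimodularity supplies y representing M ↦ tr(M E_ji), whose value at E_ij is tr(E_ii) = 1.
  obtain ⟨y, hy⟩ := quaternions.trace_form_bijective.2
    (Matrix.traceLinearMap (Fin 2) ℤ ℤ ∘ₗ LinearMap.mulRight ℤ (Matrix.single j i 1))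
  refine ⟨y, (LinearMap.congr_fun hy (Matrix.single i j 1)).trans ?_⟩
  fin_cases i <;> fin_cases j <;> simp

theorem quaternions_span_isotropic : Submodule.span ℤ quaternions.isotropic = ⊤ := by
  rw [eq_top_iff]
  rintro a -
  rw [Matrix.matrix_eq_sum_single a]
  refine Submodule.sum_mem _ fun i _ => Submodule.sum_mem _ fun j _ => ?_
  rw [show Matrix.single i j (a i j) = a i j • Matrix.single i j (1 : ℤ) by simp]
  exact Submodule.smul_mem _ _
    (Submodule.subset_span ⟨quatNorm_single i j, exists_trace_mul_quatConj_single i j⟩)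

/-- On each of the two quaternionic summands the octonion norm and trace form restrict to the
quaternionic ones, so isotropic unimodular quaternions remain so in either summand. -/
theorem octonions_span_isotropic : Submodule.span ℤ octonions.isotropic = ⊤ := by
  rw [eq_top_iff]
  have h1 : quaternions.isotropic ⊆ (Submodule.span ℤ octonions.isotropic).comap
      (LinearMap.inl ℤ (Matrix (Fin 2) (Fin 2) ℤ) (Matrix (Fin 2) (Fin 2) ℤ)) := by
    rintro x ⟨hx, y, hy⟩
    refine Submodule.subset_span ⟨?_, (y, 0), ?_⟩
    · change quatNorm x + quatNorm 0 = 0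
      rw [QuadraticMap.map_zero, add_zero]
      exact hx
    · change (y * quatConj x - quatConj (-0) * 0).trace = 1
      rw [mul_zero, sub_zero]
      exact hy
  have h2 : quaternions.isotropic ⊆ (Submodule.span ℤ octonions.isotropic).comap
      (LinearMap.inr ℤ (Matrix (Fin 2) (Fin 2) ℤ) (Matrix (Fin 2) (Fin 2) ℤ)) := by
    rintro x ⟨hx, y, hy⟩
    refine Submodule.subset_span ⟨?_, (0, y), ?_⟩
    · change quatNorm 0 + quatNorm x = 0
      rw [QuadraticMap.map_zero, zero_add]
      exact hx
    · change (0 * quatConj 0 - quatConj (-x) * y).trace = 1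
      rw [zero_mul, zero_sub, map_neg, neg_mul, neg_neg, Matrix.trace_mul_comm]
      exact hy
  rw [← Submodule.span_le, quaternions_span_isotropic] at h1 h2
  rintro ⟨a, b⟩ -
  have ha := Submodule.mem_comap.1 (h1 (Submodule.mem_top (x := a)))
  have hb := Submodule.mem_comap.1 (h2 (Submodule.mem_top (x := b)))
  rw [show (a, b) = LinearMap.inl ℤ _ _ a + LinearMap.inr ℤ _ _ b by simp]
  exact add_mem ha hb

theorem diagonal_span_rankOne : Submodule.span ℤ diagonal.rankOne = ⊤ := by
  rw [eq_top_iff]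
  rintro a -
  rw [pi_eq_sum_univ' a]
  refine Submodule.sum_mem _ fun i _ => Submodule.smul_mem _ _
    (Submodule.subset_span ⟨?_, Pi.single i 1, ?_⟩)
  · ext j
    fin_cases i <;> fin_cases j <;> simp [diagonal, QuadraticMap.ofPolar]
  · fin_cases i <;> simp [diagonal, dotProduct, Fin.sum_univ_three]

theorem proposition4 :
    Subgroup.closure (hermitian binarions).elementary = (hermitian binarions).freudenthalGroup ∧
    Subgroup.closure (hermitian quaternions).elementary =
      (hermitian quaternions).freudenthalGroup ∧
    Subgroup.closure (hermitian octonions).elementary = (hermitian octonions).freudenthalGroup ∧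
    Subgroup.closure diagonal.elementary = diagonal.freudenthalGroup :=
  ⟨JordanCubic.closure_elementary (binarions.span_rankOne binarions_span_isotropic),
    JordanCubic.closure_elementary (quaternions.span_rankOne quaternions_span_isotropic),
    JordanCubic.closure_elementary (octonions.span_rankOne octonions_span_isotropic),
    JordanCubic.closure_elementary diagonal_span_rankOne⟩
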